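/- **Setting.** Let $\mathbb F_q$ be a finite field of odd characteristic, let $n\ge 0$, and let $N=2n+1$ in type $B_n$ and $N=2n$ in types $C_n$, $D_n$; put $\tilde n=n+1$ in type $B_n$ and $\tilde n=n$ in types $C_n$, $D_n$. For $1\le k\le N$ put $\bar k=N+1-k$. Let $\triangle=\{(i,j): i<j<\bar i\}$, $\mathcal C=\{(i,j): i<j=\bar i\}$, and let $\Phi=\triangle$ in types $B_n$, $D_n$ and $\Phi=\triangle\cup\mathcal C$ in type $C_n$. Row $i$ means $\{(i,j)\in\Phi\}$; for $i\le n$ this is $\{(i,j): i<j\le\tilde i\}$, where $\tilde i=\bar i-1$ in types $B_n$, $D_n$ and $\tilde i=\bar i$ in type $C_n$. Let $U$ be the group of upper unitriangular $N\times N$ matrices $u$ over $\mathbb F_q$ with $u^tJu=J$, where $J_{k\bar k}=1$, except that $J_{k\bar k}=-1$ for $k>n$ in type $C_n$, and all other entries of $J$ are $0$. For $(i,j)\in\Phi$ and $\alpha\in\mathbb F_q$ let - type $B_n$: $x_{ij}(\alpha)=1+\alpha e_{ij}-\alpha e_{\bar j\bar i}$ if $j\ne n+1$, and $x_{i,n+1}(\alpha)=1+\alpha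 e_{i,n+1}-\alpha e_{n+1,\bar i}-\frac12\alpha^2e_{i\bar i}$; - type $C_n$: $x_{ij}(\alpha)=1+\alpha e_{ij}-\alpha e_{\bar j\bar i}$ if $j\le n$, $x_{ij}(\alpha)=1+\alpha e_{ij}+\alpha e_{\bar j\bar i}$ if $n<j<\bar i$, and $x_{i\bar i}(\alpha)=1+\alpha e_{i\bar i}$; - type $D_n$: $x_{ij}(\alpha)=1+\alpha e_{ij}-\alpha e_{\bar j\bar i}$. Let $X_{ij}=\{x_{ij}(\alpha):\alpha\in\mathbb F_q\}$ and let $R_i$ be the group generated by all $X_{ij}$ with $(i,j)\in\Phi$. Let $V$ be the space of $N\times N$ matrices over $\mathbb F_q$ with support in $\Phi$, let $\pi$ be the projection of the space of all matrices onto $V$ that sets the entries outside $\Phi$ to $0$, and fix a non-trivial character $\theta:(\mathbb F_q,+)\to\mathbb C^*$. For $A\in V$ let $[A]$ be the character $B\mapsto\theta(\operatorname{tr}((-A)^tB))$ of $(V,+)$. For a character $\chi$ of $(V,+)$ and $g\in U$ put $(\chi.g)(B)=\chi(\pi(Bg^{-1}))$. Let $\mathrm{Stab}_U[A]=\{u\in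 U:[A].u=[A]\}$ and $\mathrm{Stab}^i_U[A]=\mathrm{Stab}_U[A]\cap R_i$. A *main condition* of $A\in V$ is the position of the rightmost non-zero entry of a non-zero row; it is a *left* or *right* main condition if its column $j$ satisfies $j\le\tilde n$ or $j>\tilde n$ respectively. $[A]$ is *staircase* if its main conditions lie in pairwise different columns. The *minor conditions* are the positions $(i,\bar j)$ with $(i,j)$ a right main condition. A *supplementary condition* is a position $(i,j)\in\Phi$ with $j\le\tilde n$ that is strictly to the left, in its row, of a minor condition or of a left main condition, lies in the same column as some minor condition, and is itself neither a minor nor a main condition. $\mathrm{core}(A)$ consists of the main and supplementary conditions and, in types $B_n$, $D_n$ only, also of the minor conditions. A staircase $[A]$ is a *core* if $\operatorname{supp}A\subseteq\mathrm{core}(A)$. $\mathrm{Limb}(A)$ is the union, over all main conditions $(i,j)$ of $A$, of the arm $\{(\bar j,a)\in\triangle\}$ and the leg $\{(a,j)\in\triangle: a>i\}$, together with, in type $C_n$, all $(\bar j,j)\in\mathcal C$ such that some $(i,j)\in\triangle$ is a right main condition. **Theorem.** Let $[A]$ be a staircase core. For $1\le i\le n$ let $A_i=(A_{ab})_{1\le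 a<i,\; i<b\le\tilde i}$, and for $\underline\alpha=(\alpha_{i+1},\dots,\alpha_{\tilde i})^t$ put $x(\underline\alpha)=x_{i,i+1}(\alpha_{i+1})\cdots x_{i,\tilde i}(\alpha_{\tilde i})$. Then $$\mathrm{Stab}^i_U[A]=\begin{cases}\{1\}&\text{if row } i\text{ is contained in }\mathrm{Limb}(A),\\ X_{i\bar i}&\text{if the type is }C_n\text{ and }(i,\bar i)\text{ is a main condition of }A,\\ \{x(\underline\alpha): A_i\underline\alpha=0\}&\text{otherwise.}\end{cases}$$ Moreover $(y_1,\dots,y_n)\mapsto y_1y_2\cdots y_n$ is a bijection from $\prod_{i=1}^n\mathrm{Stab}^i_U[A]$ onto $\mathrm{Stab}_U[A]$; that is, $\mathrm{Stab}_U[A]$ is the product of its row pieces and each of its elements factors uniquely in this way. -/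

import Mathlib

open Matrix

namespace ClassicalSylow

/-- The three families of (untwisted) classical types considered. -/
inductive LieType
  | B
  | C
  | D
  deriving DecidableEq

/-- The size `N` of the matrices: `2n+1` in type `B_n`, and `2n` in types `C_n`, `D_n`. -/
def dim : LieType → ℕ → ℕ
  | .B, n => 2 * n + 1
  | .C, n => 2 * n
  | .D, n => 2 * n

/-- The number `ñ`: `n+1` in type `B_n`, and `n` in types `C_n`, `D_n`. -/
def ntilde : LieType → ℕ → ℕ
  | .B, n => n + 1
  | .C, n => n
  | .D, n => n

/-- Row and column indices. The index written `k` in the usual `1`-based numbering is the element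
of `Fin N` with value `k - 1`; the mirror map `k ↦ N + 1 - k` is `Fin.rev`. -/
abbrev Idx (t : LieType) (n : ℕ) := Fin (dim t n)

lemma le_dim (t : LieType) (n : ℕ) : n ≤ dim t n := by
  cases t <;> simp only [dim] <;> omega

/-- The rows `1, …, n`, as indices. -/
def rowIdx (t : LieType) {n : ℕ} (i : Fin n) : Idx t n := Fin.castLE (le_dim t n) i

/-- The open upper triangle `i < j < ī`. -/
def UP (t : LieType) (n : ℕ) : Set (Idx t n × Idx t n) :=
  {p | p.1 < p.2 ∧ p.2 < p.1.rev}

/-- The upper half of the anti-diagonal, `i < j = ī`. -/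
def CC (t : LieType) (n : ℕ) : Set (Idx t n × Idx t n) :=
  {p | p.1 < p.2 ∧ p.2 = p.1.rev}

/-- The set of positions labelling the root subgroups. -/
def pUP : (t : LieType) → (n : ℕ) → Set (Idx t n × Idx t n)
  | .B, n => UP .B n
  | .C, n => UP .C n ∪ CC .C n
  | .D, n => UP .D n

lemma lt_of_mem_pUP {t : LieType} {n : ℕ} {p : Idx t n × Idx t n} (h : p ∈ pUP t n) :
    p.1 < p.2 := by
  cases t
  · exact h.1
  · exact h.elim (fun h => h.1) (fun h => h.1)
  · exact h.1

/-- Positions of `pUP` in columns `j ≤ ñ` (in `1`-based numbering). -/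
def triL (t : LieType) (n : ℕ) : Set (Idx t n × Idx t n) :=
  {p | p ∈ pUP t n ∧ p.2.val < ntilde t n}

/-- Positions of `pUP` in columns `j > ñ` (in `1`-based numbering). -/
def triR (t : LieType) (n : ℕ) : Set (Idx t n × Idx t n) :=
  {p | p ∈ pUP t n ∧ ntilde t n ≤ p.2.val}

/-! ### The groups -/

section Groups

variable {F : Type*} [Field F]

/-- The group of upper unitriangular matrices. -/
def unitriangular (N : ℕ) (F : Type*) [Field F] : Subgroup (GL (Fin N) F) where
  carrier := {g | (∀ i j, j < i → (g : Matrix (Fin N) (Fin N) F) i j = 0) ∧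
    ∀ i, (g : Matrix (Fin N) (Fin N) F) i i = 1}
  one_mem' := ⟨fun i j h => by simp [h.ne'], fun i => by simp⟩
  mul_mem' := by
    rintro a b ⟨ha, ha'⟩ ⟨hb, hb'⟩
    refine ⟨fun i j h => ?_, fun i => ?_⟩
    · rw [Units.val_mul, Matrix.mul_apply]
      refine Finset.sum_eq_zero fun k _ => ?_
      rcases lt_or_ge k i with hk | hk
      · rw [ha i k hk, zero_mul]
      · rw [hb k j (lt_of_lt_of_le h hk), mul_zero]
    · rw [Units.val_mul, Matrix.mul_apply, Finset.sum_eq_single i, ha', hb', one_mul]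
      · intro k _ hk
        rcases lt_or_gt_of_ne hk with hk | hk
        · rw [ha i k hk, zero_mul]
        · rw [hb k i hk, mul_zero]
      · simp
  inv_mem' := by
    rintro g ⟨hg, hg'⟩
    have hlow : ∀ i j, j < i → ((g⁻¹ : GL (Fin N) F) : Matrix (Fin N) (Fin N) F) i j = 0 := by
      have hb : BlockTriangular (g : Matrix (Fin N) (Fin N) F) id := fun i j h => hg i j h
      have : Invertible (g : Matrix (Fin N) (Fin N) F) := g.isUnit.invertible
      have hi := blockTriangular_inv_of_blockTriangular hb
      intro i j h
      rw [Matrix.coe_units_inv]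
      exact hi h
    refine ⟨hlow, fun i => ?_⟩
    have h1 : ((g : Matrix (Fin N) (Fin N) F) *
        ((g⁻¹ : GL (Fin N) F) : Matrix (Fin N) (Fin N) F)) i i = 1 := by
      rw [← Units.val_mul, mul_inv_cancel, Units.val_one, Matrix.one_apply_eq]
    rw [Matrix.mul_apply, Finset.sum_eq_single i, hg', one_mul] at h1
    · exact h1
    · intro k _ hk
      rcases lt_or_gt_of_ne hk with hk | hk
      · rw [hg i k hk, zero_mul]
      · rw [hlow k i hk, mul_zero]
    · simp

/-- The Gram matrix of the standard form: the anti-diagonal matrix with all entries `1`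
(types `B_n`, `D_n`, symmetric), respectively with entries `1` in rows `1, …, n` and `-1` in rows
`n+1, …, 2n` (type `C_n`, alternating). -/
def gram (t : LieType) (n : ℕ) (F : Type*) [Field F] : Matrix (Idx t n) (Idx t n) F :=
  Matrix.of fun k l => if l = k.rev then (if t = .C ∧ n ≤ k.val then -1 else 1) else 0

/-- The isometry group of the standard form. -/
def isometryGroup (t : LieType) (n : ℕ) (F : Type*) [Field F] : Subgroup (GL (Idx t n) F) where
  carrier := {g | (g : Matrix (Idx t n) (Idx t n) F)ᵀ * gram t n F *
    (g : Matrix (Idx t n) (Idx t n) F) = gram t n F}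
  one_mem' := by simp
  mul_mem' := by
    intro a b ha hb
    simp only [Set.mem_ofPred_eq] at ha hb ⊢
    rw [Units.val_mul, Matrix.transpose_mul]
    calc _ = (b : Matrix (Idx t n) (Idx t n) F)ᵀ *
          ((a : Matrix (Idx t n) (Idx t n) F)ᵀ * gram t n F *
            (a : Matrix (Idx t n) (Idx t n) F)) * (b : Matrix (Idx t n) (Idx t n) F) := by
          simp only [Matrix.mul_assoc]
      _ = _ := by rw [ha, hb]
  inv_mem' := by
    intro g hg
    simp only [Set.mem_ofPred_eq] at hg ⊢
    have h1 : (g : Matrix (Idx t n) (Idx t n) F) *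
        ((g⁻¹ : GL (Idx t n) F) : Matrix (Idx t n) (Idx t n) F) = 1 := by
      rw [← Units.val_mul, mul_inv_cancel, Units.val_one]
    have h2 : ((g⁻¹ : GL (Idx t n) F) : Matrix (Idx t n) (Idx t n) F)ᵀ *
        (g : Matrix (Idx t n) (Idx t n) F)ᵀ = 1 := by
      rw [← Matrix.transpose_mul, h1, Matrix.transpose_one]
    generalize ((g⁻¹ : GL (Idx t n) F) : Matrix (Idx t n) (Idx t n) F) = h at h1 h2 ⊢
    calc hᵀ * gram t n F * h
        = hᵀ * ((g : Matrix (Idx t n) (Idx t n) F)ᵀ * gram t n F *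
            (g : Matrix (Idx t n) (Idx t n) F)) * h := by rw [hg]
      _ = (hᵀ * (g : Matrix (Idx t n) (Idx t n) F)ᵀ) * gram t n F *
            ((g : Matrix (Idx t n) (Idx t n) F) * h) := by simp only [Matrix.mul_assoc]
      _ = gram t n F := by rw [h1, h2, one_mul, mul_one]

/-- The group `U` of type `B_n`, `C_n`, `D_n`: the upper unitriangular isometries of the standard
form. Over a finite field of odd characteristic `p` it is the `p`-Sylow subgroup of the
corresponding classical group. -/
def U (t : LieType) (n : ℕ) (F : Type*) [Field F] : Subgroup (GL (Idx t n) F) :=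
  unitriangular (dim t n) F ⊓ isometryGroup t n F

/-- The matrix of the root element `x_{ij}(α)`, for a position `(i,j)` of `pUP`. -/
def rootMatrix : (t : LieType) → (n : ℕ) → (i j : Idx t n) → F → Matrix (Idx t n) (Idx t n) F
  | .B, n, i, j, α =>
    if j.val = n then
      1 + single i j α - single j i.rev α - single i i.rev (α ^ 2 / 2)
    else 1 + single i j α - single j.rev i.rev α
  | .C, n, i, j, α =>
    if j = i.rev then 1 + single i j α
    else if j.val < n then 1 + single i j α - single j.rev i.rev α
    else 1 + single i j α + single j.rev i.rev α
  | .D, _, i, j, α => 1 + single i j α - single j.rev i.rev α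

/-- `M` is upper unitriangular. -/
def IsUnitri {N : ℕ} (M : Matrix (Fin N) (Fin N) F) : Prop :=
  (∀ i j, j < i → M i j = 0) ∧ ∀ i, M i i = 1

lemma IsUnitri.add_single {N : ℕ} {M : Matrix (Fin N) (Fin N) F} (hM : IsUnitri M)
    {i j : Fin N} (h : i < j) (a : F) : IsUnitri (M + single i j a) := by
  refine ⟨fun k l hkl => ?_, fun k => ?_⟩
  · rw [Matrix.add_apply, hM.1 k l hkl, single_apply_of_ne, add_zero]
    rintro ⟨rfl, rfl⟩
    exact lt_asymm h hkl
  · rw [Matrix.add_apply, hM.2 k, single_apply_of_ne, add_zero]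
    rintro ⟨rfl, rfl⟩
    exact lt_irrefl _ h

lemma IsUnitri.sub_single {N : ℕ} {M : Matrix (Fin N) (Fin N) F} (hM : IsUnitri M)
    {i j : Fin N} (h : i < j) (a : F) : IsUnitri (M - single i j a) := by
  have h1 : single i j (-a) = -(single i j a : Matrix (Fin N) (Fin N) F) := by
    ext k l
    by_cases hkl : i = k ∧ j = l <;> simp [hkl]
  rw [sub_eq_add_neg, ← h1]
  exact hM.add_single h (-a)

lemma isUnitri_one {N : ℕ} : IsUnitri (1 : Matrix (Fin N) (Fin N) F) :=
  ⟨fun i j h => by simp [h.ne'], fun i => by simp⟩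

lemma isUnitri_rootMatrix {t : LieType} {n : ℕ} {i j : Idx t n} (h : (i, j) ∈ pUP t n) (α : F) :
    IsUnitri (rootMatrix t n i j α) := by
  have hij : i < j := lt_of_mem_pUP h
  have hji : j.rev < i.rev := Fin.rev_lt_rev.2 hij
  have h1 := (isUnitri_one (F := F)).add_single hij α
  cases t with
  | B =>
    have hii : j < i.rev := h.2
    simp only [rootMatrix]
    split_ifs
    · exact (h1.sub_single hii α).sub_single (hij.trans hii) _
    · exact h1.sub_single hji α
  | C =>
    simp only [rootMatrix]
    split_ifs
    · exact h1
    · exact h1.sub_single hji α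
    · exact h1.add_single hji α
  | D => exact h1.sub_single hji α

lemma IsUnitri.det_ne_zero {N : ℕ} {M : Matrix (Fin N) (Fin N) F} (hM : IsUnitri M) :
    M.det ≠ 0 := by
  rw [det_of_isUpperTriangular (M := M) (fun i j h => hM.1 i j h)]
  simp [hM.2]

open Classical in
/-- The root element `x_{ij}(α)`, for a position `(i,j)` of `pUP` (the value `1` at all other
positions is not used). -/
noncomputable def x (t : LieType) (n : ℕ) (i j : Idx t n) (α : F) : GL (Idx t n) F :=
  if h : (i, j) ∈ pUP t n then
    GeneralLinearGroup.mkOfDetNeZero (rootMatrix t n i j α) (isUnitri_rootMatrix h α).det_ne_zero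
  else 1

lemma coe_x {t : LieType} {n : ℕ} {i j : Idx t n} (h : (i, j) ∈ pUP t n) (α : F) :
    (x t n i j α : Matrix (Idx t n) (Idx t n) F) = rootMatrix t n i j α := by
  rw [x, dif_pos h]
  rfl

/-- The root subgroup `X_{ij} = {x_{ij}(α) | α ∈ F}`. -/
def X (t : LieType) (n : ℕ) (F : Type*) [Field F] (i j : Idx t n) : Set (GL (Idx t n) F) :=
  {g | ∃ α : F, g = x t n i j α}

/-- The row group `R_i`, generated by the root subgroups `X_{ij}` with `(i,j)` in `pUP`
(for `i ≤ n` these are the `j` with `i < j < ī` in types `B_n`, `D_n`, and with `i < j ≤ ī` in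
type `C_n`). -/
def rowGroup (t : LieType) (n : ℕ) (F : Type*) [Field F] (i : Idx t n) :
    Subgroup (GL (Idx t n) F) :=
  Subgroup.closure {g | ∃ j, (i, j) ∈ pUP t n ∧ g ∈ X t n F i j}

/-- The column indices `j` of the positions `(i,j)` of `pUP` in row `i`. -/
abbrev RowCols (t : LieType) (n : ℕ) (i : Idx t n) := {j : Idx t n // (i, j) ∈ pUP t n}

open Classical in
/-- The ordered product `x(α) = x_{i,i+1}(α_{i+1}) x_{i,i+2}(α_{i+2}) ⋯`, taken over all positions
of `pUP` in row `i` from left to right. -/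
noncomputable def xRow {t : LieType} {n : ℕ} (i : Idx t n) (α : RowCols t n i → F) :
    GL (Idx t n) F :=
  ((List.finRange (dim t n)).map fun j =>
    if h : (i, j) ∈ pUP t n then x t n i j (α ⟨j, h⟩) else 1).prod

end Groups

/-! ### The linear characters `[A]` and the permutation action -/

section Characters

variable {F : Type*} [Field F] {t : LieType} {n : ℕ}

/-- The space `V` of all matrices with support in `pUP`. -/
def V (t : LieType) (n : ℕ) (F : Type*) [Field F] : Submodule F (Matrix (Idx t n) (Idx t n) F) where
  carrier := {A | ∀ i j, (i, j) ∉ pUP t n → A i j = 0}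
  zero_mem' := fun _ _ _ => rfl
  add_mem' := fun ha hb i j h => by rw [Matrix.add_apply, ha i j h, hb i j h, add_zero]
  smul_mem' := fun c _ ha i j h => by rw [Matrix.smul_apply, ha i j h, smul_zero]

open Classical in
/-- The projection `π` onto `V`, which sets all entries outside of `pUP` to zero. -/
noncomputable def proj (t : LieType) (n : ℕ) (F : Type*) [Field F] :
    Matrix (Idx t n) (Idx t n) F →ₗ[F] V t n F where
  toFun M := ⟨Matrix.of fun i j => if (i, j) ∈ pUP t n then M i j else 0,
    fun i j h => by simp [h]⟩
  map_add' M M' := by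
    ext i j
    by_cases h : (i, j) ∈ pUP t n <;> simp [h]
  map_smul' c M := by
    ext i j
    by_cases h : (i, j) ∈ pUP t n <;> simp [h]

/-- The map `V → V`, `A ↦ A.g = π(A g)`. -/
noncomputable def dot (g : GL (Idx t n) F) : V t n F →+ V t n F where
  toFun A := proj t n F ((A : Matrix (Idx t n) (Idx t n) F) * (g : Matrix (Idx t n) (Idx t n) F))
  map_zero' := by simp
  map_add' A B := by simp [Matrix.add_mul]

/-- The bilinear form `κ(A, B) = tr(Aᵗ B)`. -/
def kappa (A B : Matrix (Idx t n) (Idx t n) F) : F := (Aᵀ * B).trace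

/-- The linear character `χ_A = θ ∘ κ(A, -)` of the additive group of `V`. -/
def chi (θ : AddChar F ℂ) (A : V t n F) : AddChar (V t n F) ℂ where
  toFun B := θ (kappa (A : Matrix (Idx t n) (Idx t n) F) B)
  map_zero_eq_one' := by simp [kappa]
  map_add_eq_mul' B C := by simp [kappa, Matrix.mul_add, AddChar.map_add_eq_mul]

/-- The linear character `[A] = χ_{-A}`. -/
def bracket (θ : AddChar F ℂ) (A : V t n F) : AddChar (V t n F) ℂ := chi θ (-A)

/-- The permutation action on linear characters, `(χ.g)(B) = χ(B.g⁻¹)`. -/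
noncomputable def charDot (χ : AddChar (V t n F) ℂ) (g : GL (Idx t n) F) :
    AddChar (V t n F) ℂ :=
  χ.compAddMonoidHom (dot g⁻¹)

/-- The stabilizer `Stab_U[A] = {u ∈ U | [A].u = [A]}`. -/
def Stab (θ : AddChar F ℂ) (A : V t n F) : Set (GL (Idx t n) F) :=
  {u | u ∈ U t n F ∧ charDot (bracket θ A) u = bracket θ A}

/-- `Stab_U[A] ∩ R_i`. -/
def StabRow (θ : AddChar F ℂ) (A : V t n F) (i : Idx t n) : Set (GL (Idx t n) F) :=
  Stab θ A ∩ (rowGroup t n F i : Set (GL (Idx t n) F))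

end Characters

/-! ### Main conditions, cores and limbs -/

section Cores

variable {F : Type*} [Field F] {t : LieType} {n : ℕ}

/-- The support of `A`. -/
def supp (A : V t n F) : Set (Idx t n × Idx t n) := {p | A.1 p.1 p.2 ≠ 0}

/-- The main conditions: positions of the rightmost non-zero entries of the non-zero rows. -/
def mainc (A : V t n F) : Set (Idx t n × Idx t n) :=
  {p | p ∈ pUP t n ∧ A.1 p.1 p.2 ≠ 0 ∧ ∀ k, p.2 < k → A.1 p.1 k = 0}

/-- The left main conditions. -/
def lmc (A : V t n F) : Set (Idx t n × Idx t n) := mainc A ∩ triL t n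

/-- The right main conditions. -/
def rmc (A : V t n F) : Set (Idx t n × Idx t n) := mainc A ∩ triR t n

/-- `[A]` is a staircase character: the main conditions lie in pairwise different columns. -/
def IsStaircase (A : V t n F) : Prop :=
  ∀ p ∈ mainc A, ∀ p' ∈ mainc A, p.2 = p'.2 → p = p'

/-- The minor conditions `(i, j̄)`, for right main conditions `(i,j)`. -/
def minc (A : V t n F) : Set (Idx t n × Idx t n) :=
  {p | (p.1, p.2.rev) ∈ rmc A}

/-- The supplementary conditions. -/
def suppl (A : V t n F) : Set (Idx t n × Idx t n) :=
  {p | p ∈ triL t n ∧ (∃ k, p.2 < k ∧ ((p.1, k) ∈ minc A ∨ (p.1, k) ∈ lmc A)) ∧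
    (∃ k, (k, p.2) ∈ minc A) ∧ p ∉ minc A ∧ p ∉ mainc A}

/-- The set of positions `core(A)`. -/
def core : {t : LieType} → V t n F → Set (Idx t n × Idx t n)
  | .B, A => mainc A ∪ minc A ∪ suppl A
  | .C, A => mainc A ∪ suppl A
  | .D, A => mainc A ∪ minc A ∪ suppl A

/-- `[A]` is a core character. -/
def IsCore (A : V t n F) : Prop := mainc A ⊆ supp A ∧ supp A ⊆ core A

/-- The arm of the position `(i,j)`: all positions of `UP` in row `j̄`. -/
def arm (p : Idx t n × Idx t n) : Set (Idx t n × Idx t n) :=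
  {r | r ∈ UP t n ∧ r.1 = p.2.rev}

/-- The leg of the position `(i,j)`: all positions of `UP` in column `j` below row `i`. -/
def leg (p : Idx t n × Idx t n) : Set (Idx t n × Idx t n) :=
  {r | r ∈ UP t n ∧ r.2 = p.2 ∧ p.1 < r.1}

/-- The union of the arms and the legs of all main conditions. -/
def limb₀ (A : V t n F) : Set (Idx t n × Idx t n) := ⋃ p ∈ mainc A, arm p ∪ leg p

/-- The positions `(j̄, j)` on the anti-diagonal, for right main conditions `(i,j)` in `UP`. -/
def limbC (A : V t n F) : Set (Idx t n × Idx t n) :=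
  {r | r ∈ CC t n ∧ ∃ i, (i, r.2) ∈ rmc A ∩ UP t n}

/-- The set of positions `Limb(A)`. -/
def Limb : {t : LieType} → V t n F → Set (Idx t n × Idx t n)
  | .B, A => limb₀ A
  | .C, A => limb₀ A ∪ limbC A
  | .D, A => limb₀ A

/-- The set of positions of `pUP` in row `i`. -/
def rowPos (t : LieType) (n : ℕ) (i : Idx t n) : Set (Idx t n × Idx t n) :=
  {p | p ∈ pUP t n ∧ p.1 = i}

/-- The submatrix `A_i` of `A` on the rows `a < i` and on the columns `b` with `(i,b)` in
`pUP`. -/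
def subMat (A : V t n F) (i : Idx t n) : Matrix {a : Idx t n // a < i} (RowCols t n i) F :=
  A.1.submatrix Subtype.val Subtype.val

open Classical in
/-- The solution space of the homogeneous system `A_i α = 0`. -/
noncomputable def solSpace (A : V t n F) (i : Idx t n) : Submodule F (RowCols t n i → F) :=
  LinearMap.ker (subMat A i).mulVecLin

end Cores

end ClassicalSylow

open ClassicalSylow

namespace ClassicalSylow

/-! Moving `g⁻¹` across the trace form shows that `[A].g = [A]` compares `A` with `A (g⁻¹)ᵗ` on
`pUP`. At positions above the diagonal outside `pUP` both matrices vanish anyway, so agreement may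
be required everywhere above the diagonal. In that form the condition is visibly closed under
products, and finiteness supplies inverses: the stabilizer is `fixMat A` (`mem_Stab_iff`).

The group `R_i` consists of the elements of `U` that differ from `1` only in row `i` and column `ī`
(`mem_rowGroup_iff`). Splitting off such elements successively (`fixRows_decomposition`) factors `U`
uniquely into row groups. What remains is that the row factors of a stabilizing element stabilize
too (`left_mem_fixMat`).

Let `y w` stabilize `A`, with `y` in `R_i` and `w` trivial in its rows up to `i`; everything depends
on column `ī` of `A`. If that column is zero, `A (y w)ᵗ` and `A wᵗ` differ at most in column `i`,
where `w` has no effect. So `w` stabilizes, hence `y` does, and the condition on `y` is the linear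
system `A_i α = 0`. If some `A_{aī}` is non-zero, the core property makes `(a,ī)` a main condition
with no other non-zero entry of row `a` to the right of column `i` (`IsCore.apply_rev_ne_zero`). Row
`a` of the stabilizer condition then forces the row of `y` to be trivial between columns `i` and
`ī`. For `a < i` it also kills the corner entry `(i,ī)`, so `y = 1`; for `a = i`, possible only in
type `C`, the corner stays free and gives `X_{iī}`.

A row can also lie in `Limb A` because every position of it is on a leg. Then the linear system is
triangular with non-zero pivots, and again `y = 1` (`stabRow_eq_one`). -/

lemma _root_.Submonoid.inv_mem_of_finite {G : Type*} [Group G] [Finite G] (S : Submonoid G) {g : G}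
    (hg : g ∈ S) : g⁻¹ ∈ S := by
  have h : g⁻¹ = g ^ (orderOf g - 1) := by
    refine inv_eq_of_mul_eq_one_right ?_
    rw [← pow_succ', Nat.sub_add_cancel (orderOf_pos g), pow_orderOf_eq_one]
  rw [h]
  exact S.pow_mem hg _

/-! ### The index set and its mirror map. -/

section Indices

variable {t : LieType} {n : ℕ}

lemma dim_eq (t : LieType) (n : ℕ) : dim t n = n + ntilde t n := by
  cases t <;> simp only [dim, ntilde] <;> omega

lemma le_ntilde (t : LieType) (n : ℕ) : n ≤ ntilde t n := by
  cases t <;> simp only [ntilde] <;> omega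

lemma ntilde_le (t : LieType) (n : ℕ) : ntilde t n ≤ n + 1 := by
  cases t <;> simp only [ntilde] <;> omega

lemma mem_pUP_iff {i j : Idx t n} :
    (i, j) ∈ pUP t n ↔ i < j ∧ (j < i.rev ∨ t = .C ∧ j = i.rev) := by
  cases t <;> simp [pUP, UP, CC, and_or_left]

@[simp] lemma rowIdx_val (i : Fin n) : (rowIdx t i).val = i.val := rfl

lemma rowIdx_lt_rev (i : Fin n) : rowIdx t i < (rowIdx t i).rev := by
  have := dim_eq t n
  have := le_ntilde t n
  rw [Fin.lt_def, Fin.val_rev, rowIdx_val]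
  omega

end Indices

/-! ### The form, and what isometry imposes on rows, columns and inverses. -/

section Form

variable {F : Type*} [Field F] {t : LieType} {n : ℕ}

/-- The sign of row `k` of the Gram matrix. -/
def gramSign (t : LieType) (n : ℕ) (F : Type*) [Field F] (k : Idx t n) : F :=
  if t = .C ∧ n ≤ k.val then -1 else 1

lemma gramSign_ne_zero (k : Idx t n) : gramSign t n F k ≠ 0 := by
  unfold gramSign
  split_ifs <;> simp

lemma gramSign_of_ne (ht : t ≠ .C) (k : Idx t n) : gramSign t n F k = 1 := by
  simp [gramSign, ht]

lemma gramSign_of_lt {k : Idx t n} (hk : k.val < n) : gramSign t n F k = 1 := by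
  simp [gramSign, hk]

lemma gramSign_of_le {k : Idx .C n} (hk : n ≤ k.val) : gramSign .C n F k = -1 := by
  simp [gramSign, hk]

lemma gram_apply (k l : Idx t n) :
    gram t n F k l = if l = k.rev then gramSign t n F k else 0 := rfl

lemma gram_mul_apply (M : Matrix (Idx t n) (Idx t n) F) (k l : Idx t n) :
    (gram t n F * M) k l = gramSign t n F k * M k.rev l := by
  simp [Matrix.mul_apply, gram_apply]

lemma mul_gram_apply (M : Matrix (Idx t n) (Idx t n) F) (k l : Idx t n) :
    (M * gram t n F) k l = M k l.rev * gramSign t n F l.rev := by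
  rw [Matrix.mul_apply, Finset.sum_eq_single l.rev]
  · simp [gram_apply]
  · intro m _ hm
    rw [gram_apply, if_neg, mul_zero]
    rintro rfl
    exact hm (Fin.rev_rev m).symm
  · simp

lemma gram_mul_single (i j : Idx t n) (a : F) :
    gram t n F * single i j a = single i.rev j (gramSign t n F i.rev * a) := by
  ext k l
  rw [gram_mul_apply, single_apply, single_apply]
  have : i = k.rev ↔ i.rev = k := by rw [← Fin.rev_eq_iff]
  by_cases h : i.rev = k
  · subst h
    simp
  · rw [if_neg (by rw [this]; tauto), if_neg (by tauto), mul_zero]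

lemma single_mul_gram (i j : Idx t n) (a : F) :
    single j i a * gram t n F = single j i.rev (a * gramSign t n F i) := by
  ext k l
  rw [mul_gram_apply, single_apply, single_apply]
  have : i = l.rev ↔ i.rev = l := by rw [← Fin.rev_eq_iff]
  by_cases h : i.rev = l
  · subst h
    simp
  · rw [if_neg (by rw [this]; tauto), if_neg (by tauto), zero_mul]

/-- Rewriting `gᵗ J g = J` as `(g⁻¹)ᵗ J = J g` shows that inversion is, up to signs, reflection in
the anti-diagonal. Every passage from row `i` to column `ī` rests on this. -/
lemma inv_apply_eq {g : GL (Idx t n) F} (hg : g ∈ U t n F) (a b : Idx t n) :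
    gramSign t n F a * (g⁻¹).1 a b = gramSign t n F b * g.1 b.rev a.rev := by
  have h : g.1ᵀ * gram t n F * g.1 = gram t n F := hg.2
  have h1 : ((g⁻¹).1)ᵀ * g.1ᵀ = 1 := by
    rw [← Matrix.transpose_mul, ← Units.val_mul, mul_inv_cancel, Units.val_one,
      Matrix.transpose_one]
  have h2 : ((g⁻¹).1)ᵀ * gram t n F = gram t n F * g.1 := by
    rw [← h, ← Matrix.mul_assoc, ← Matrix.mul_assoc, h1, one_mul, h]
  have h3 := congrFun (congrFun h2 b) a.rev
  rw [mul_gram_apply, gram_mul_apply, Fin.rev_rev, Matrix.transpose_apply] at h3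
  rw [← h3, mul_comm]

lemma inv_row_eq {g : GL (Idx t n) F} {i : Idx t n}
    (h : ∀ b, g.1 i b = (1 : Matrix (Idx t n) (Idx t n) F) i b) (b : Idx t n) :
    (g⁻¹).1 i b = (1 : Matrix (Idx t n) (Idx t n) F) i b := by
  have h1 : (g.1 * (g⁻¹).1) i b = (1 : Matrix (Idx t n) (Idx t n) F) i b := by
    rw [← Units.val_mul, mul_inv_cancel, Units.val_one]
  rw [← h1, Matrix.mul_apply, Finset.sum_eq_single i]
  · simp [h]
  · intro k _ hk
    simp [h, Matrix.one_apply_ne hk.symm]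
  · simp

lemma col_eq_of_row_eq {g : GL (Idx t n) F} (hg : g ∈ U t n F) {i : Idx t n}
    (h : ∀ b, g.1 i b = (1 : Matrix (Idx t n) (Idx t n) F) i b) (b : Idx t n) :
    g.1 b i.rev = (1 : Matrix (Idx t n) (Idx t n) F) b i.rev := by
  have h1 := inv_apply_eq hg i b.rev
  rw [inv_row_eq h, Fin.rev_rev] at h1
  by_cases hb : b = i.rev
  · subst hb
    rw [Matrix.one_apply_eq, hg.1.2]
  · rw [Matrix.one_apply_ne hb]
    rw [Matrix.one_apply_ne (fun h => hb (by rw [h, Fin.rev_rev])), mul_zero] at h1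
    exact (mul_eq_zero.1 h1.symm).resolve_left (gramSign_ne_zero _)

/-- In types `B` and `D`, the corner entry of an isometry vanishes with the rest of its row. -/
lemma corner_eq_zero (hF : ringChar F ≠ 2) (ht : t ≠ .C) {g : GL (Idx t n) F} (hg : g ∈ U t n F)
    {i : Idx t n} (hi : i ≠ i.rev) (h : ∀ j, j ≠ i → j ≠ i.rev → g.1 i j = 0) :
    g.1 i i.rev = 0 := by
  -- The corner is fixed by the reflection, so `g` and `g⁻¹` have the same corner entry, and the
  -- corner of `g g⁻¹ = 1` is twice that entry.
  have h1 := inv_apply_eq hg i i.rev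
  rw [gramSign_of_ne ht, gramSign_of_ne ht, Fin.rev_rev, one_mul, one_mul] at h1
  have h2 : (g.1 * (g⁻¹).1) i i.rev = 0 := by
    rw [← Units.val_mul, mul_inv_cancel, Units.val_one, Matrix.one_apply_ne hi]
  rw [Matrix.mul_apply, Finset.sum_eq_add i i.rev hi
    (fun k _ hk => by rw [h k hk.1 hk.2, zero_mul]) (by simp) (by simp), hg.1.2,
    (inv_mem hg).1.2, one_mul, mul_one, h1, ← two_mul] at h2
  exact (mul_eq_zero.1 h2).resolve_left (Ring.two_ne_zero hF)

end Form

/-! ### Root elements are isometries, and their entries. -/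

section RootElements

variable {F : Type*} [Field F] {t : LieType} {n : ℕ}

lemma single_mul_single_ite {N : ℕ} (i j k l : Fin N) (a b : F) :
    single i j a * single k l b = if j = k then single i l (a * b) else 0 := by
  split_ifs with h
  · rw [h, single_mul_single_same]
  · rw [single_mul_single_of_ne _ _ _ _ h]

lemma rootMatrix_isometry (hF : ringChar F ≠ 2) {i j : Idx t n} (h : (i, j) ∈ pUP t n) (α : F) :
    (rootMatrix t n i j α)ᵀ * gram t n F * rootMatrix t n i j α = gram t n F := by
  have h2 : (2 : F) ≠ 0 := Ring.two_ne_zero hF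
  obtain ⟨hij, hj⟩ := mem_pUP_iff.1 h
  have hii : i < i.rev := by
    rcases hj with hj | ⟨-, hj⟩
    · exact hij.trans hj
    · rwa [← hj]
  have e1 : i.rev ≠ i := hii.ne'
  have e2 : i.rev ≠ j.rev := fun e => hij.ne (Fin.rev_injective e)
  have e3 : j ≠ i := hij.ne'
  have hi : i.val < n ∧ n ≤ i.rev.val := by
    have h1 := Fin.lt_def.1 hii
    have := dim_eq t n
    have := le_ntilde t n
    have := ntilde_le t n
    rw [Fin.val_rev] at h1 ⊢
    omega
  cases t with
  | B =>
    have s1 : ∀ k, gramSign .B n F k = 1 := gramSign_of_ne (by simp)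
    simp only [rootMatrix]
    split_ifs with hjn
    -- The middle column is its own mirror, so here alone a quadratic term `α²` survives at `(ī,ī)`.
    -- The two contributions of `-α²/2` cancel it.
    · have hjj : j.rev = j := by
        ext
        rw [Fin.val_rev, hjn]
        simp only [dim]
        omega
      have e4 : i.rev ≠ j := by rwa [hjj] at e2
      simp only [transpose_sub, transpose_add, transpose_one, transpose_single, sub_mul, add_mul,
        one_mul, single_mul_gram, mul_sub, mul_add, mul_one, gram_mul_single, s1, hjj,
        single_mul_single_ite]
      simp only [e1, e3, e4, if_false, if_true]
      ext k l
      simp only [Matrix.sub_apply, Matrix.add_apply, single_apply, Matrix.zero_apply]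
      split_ifs <;> first | (exfalso; tauto) | (field_simp; ring)
    · have e4 : j ≠ j.rev := by
        intro e
        have := congrArg Fin.val e
        rw [Fin.val_rev] at this
        simp only [dim] at this
        omega
      simp only [transpose_sub, transpose_add, transpose_one, transpose_single, sub_mul, add_mul,
        one_mul, single_mul_gram, mul_sub, mul_add, mul_one, gram_mul_single, s1,
        single_mul_single_ite, Fin.rev_rev]
      simp only [e1, e2, e3, e4, if_false]
      abel
  | C =>
    have e4 : j ≠ j.rev := by
      intro e
      have := congrArg Fin.val e
      rw [Fin.val_rev] at this
      simp only [dim] at this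
      omega
    have s1 : gramSign .C n F i = 1 := gramSign_of_lt hi.1
    have s2 : gramSign .C n F i.rev = -1 := gramSign_of_le hi.2
    simp only [rootMatrix]
    split_ifs with hjr hjn
    · simp only [transpose_add, transpose_one, transpose_single, add_mul,
        one_mul, single_mul_gram, mul_add, mul_one, gram_mul_single, s1, s2, hjr,
        single_mul_single_ite]
      simp only [e1, if_false, neg_mul, one_mul]
      rw [← Matrix.single_neg]
      abel
    · have s3 : gramSign .C n F j = 1 := gramSign_of_lt hjn
      have s4 : gramSign .C n F j.rev = -1 := gramSign_of_le (by
        rw [Fin.val_rev]; simp only [dim]; omega)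
      simp only [transpose_sub, transpose_add, transpose_one, transpose_single, sub_mul, add_mul,
        one_mul, single_mul_gram, mul_sub, mul_add, mul_one, gram_mul_single, s1, s2, s3, s4,
        single_mul_single_ite, Fin.rev_rev]
      simp only [e1, e2, e3, e4, if_false, mul_neg, mul_one, one_mul, neg_mul]
      abel
    · have s3 : gramSign .C n F j = -1 := gramSign_of_le (not_lt.1 hjn)
      have s4 : gramSign .C n F j.rev = 1 := gramSign_of_lt (by
        have := j.2
        rw [Fin.val_rev]; simp only [dim] at this ⊢; omega)
      simp only [transpose_add, transpose_one, transpose_single, add_mul,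
        one_mul, single_mul_gram, mul_add, mul_one, gram_mul_single, s1, s2, s3, s4,
        single_mul_single_ite, Fin.rev_rev]
      simp only [e1, e2, e3, e4, if_false, one_mul, neg_mul]
      rw [← Matrix.single_neg, ← Matrix.single_neg]
      abel
  | D =>
    have s1 : ∀ k, gramSign .D n F k = 1 := gramSign_of_ne (by simp)
    have e4 : j ≠ j.rev := by
      intro e
      have := congrArg Fin.val e
      rw [Fin.val_rev] at this
      simp only [dim] at this
      omega
    simp only [rootMatrix]
    simp only [transpose_sub, transpose_add, transpose_one, transpose_single, sub_mul, add_mul,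
      one_mul, single_mul_gram, mul_sub, mul_add, mul_one, gram_mul_single, s1,
      single_mul_single_ite, Fin.rev_rev]
    simp only [e1, e2, e3, e4, if_false]
    abel

lemma x_mem_U (hF : ringChar F ≠ 2) {i j : Idx t n} (h : (i, j) ∈ pUP t n) (α : F) :
    x t n i j α ∈ U t n F := by
  refine ⟨?_, ?_⟩
  · have := isUnitri_rootMatrix h α
    rw [← coe_x h] at this
    exact this
  · change (x t n i j α).1ᵀ * gram t n F * (x t n i j α).1 = gram t n F
    rw [coe_x h]
    exact rootMatrix_isometry hF h α

lemma x_apply_of_ne {i j : Idx t n} (h : (i, j) ∈ pUP t n) (α : F) {a b : Idx t n} (ha : a ≠ i)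
    (hb : b ≠ i.rev) : (x t n i j α).1 a b = (1 : Matrix (Idx t n) (Idx t n) F) a b := by
  rw [coe_x h]
  cases t <;> simp only [rootMatrix] <;> try split_ifs
  all_goals simp [ha.symm, hb.symm]

/-- Apart from row `i`, a root element can be non-trivial only in row `j̄`, and positions of `pUP`
satisfy `j ≤ ī`, so that row is not above row `i`. -/
lemma x_row_of_ne {i j : Idx t n} (h : (i, j) ∈ pUP t n) (α : F) {a b : Idx t n} (ha : a < i) :
     (x t n i j α).1 a b = (1 : Matrix (Idx t n) (Idx t n) F) a b := by
  rw [coe_x h]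
  obtain ⟨hij, hj⟩ := mem_pUP_iff.1 h
  have h1 : a ≠ j.rev := by
    rintro rfl
    have : i.rev < j := by rw [← Fin.rev_lt_rev, Fin.rev_rev]; exact ha
    rcases hj with hj | ⟨-, hj⟩
    · exact lt_asymm this hj
    · exact this.ne hj.symm
  have h2 : a ≠ j := (ha.trans hij).ne
  cases t <;> simp only [rootMatrix] <;> try split_ifs
  all_goals simp [ha.ne', h1.symm, h2.symm]

lemma x_apply_row {i j : Idx t n} (h : (i, j) ∈ pUP t n) (α : F) {b : Idx t n} (hi : b ≠ i)
    (hb : b ≠ i.rev) : (x t n i j α).1 i b = if b = j then α else 0 := by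
  rw [coe_x h]
  cases t <;> simp only [rootMatrix] <;> try split_ifs
  all_goals
    simp_all [hb.symm, Matrix.one_apply_ne hi.symm, eq_comm (a := b)]

end RootElements

/-! ### Row groups described by matrix entries, and the filtration of `U` by trivial rows. -/

section RowElements

variable {F : Type*} [Field F] {t : LieType} {n : ℕ}

/-- The elements of `U` whose first `k` rows are those of the identity matrix. -/
def fixRows (t : LieType) (n : ℕ) (F : Type*) [Field F] (k : ℕ) : Submonoid (GL (Idx t n) F) where
  carrier := {g | g ∈ U t n F ∧ ∀ a b : Idx t n, a.val < k →
    g.1 a b = (1 : Matrix (Idx t n) (Idx t n) F) a b}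
  one_mem' := ⟨one_mem _, fun _ _ _ => rfl⟩
  mul_mem' := by
    rintro g h ⟨hg, hg'⟩ ⟨hh, hh'⟩
    refine ⟨mul_mem hg hh, fun a b ha => ?_⟩
    rw [Units.val_mul, Matrix.mul_apply, Finset.sum_eq_single a]
    · rw [hg' a a ha, hh' a b ha, Matrix.one_apply_eq, one_mul]
    · intro k _ hk
      rw [hg' a k ha, Matrix.one_apply_ne hk.symm, zero_mul]
    · simp

lemma fixRows_anti {k l : ℕ} (h : k ≤ l) : fixRows t n F l ≤ fixRows t n F k :=
  fun _ hg => ⟨hg.1, fun a b ha => hg.2 a b (ha.trans_le h)⟩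

lemma mem_fixRows_zero {g : GL (Idx t n) F} : g ∈ fixRows t n F 0 ↔ g ∈ U t n F :=
  ⟨fun h => h.1, fun h => ⟨h, fun _ _ h => absurd h (Nat.not_lt_zero _)⟩⟩

lemma fixRows_col {k : ℕ} {g : GL (Idx t n) F} (hg : g ∈ fixRows t n F k) (a b : Idx t n)
    (hb : b.rev.val < k) : g.1 a b = (1 : Matrix (Idx t n) (Idx t n) F) a b := by
  have := col_eq_of_row_eq hg.1 (i := b.rev) (fun c => hg.2 _ c hb) a
  rwa [Fin.rev_rev] at this

lemma eq_one_of_mem_fixRows {g : GL (Idx t n) F} (hg : g ∈ fixRows t n F n) : g = 1 := by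
  refine Units.ext (Matrix.ext fun a b => ?_)
  by_cases ha : a.val < n
  · exact hg.2 a b ha
  by_cases hb : b.rev.val < n
  · exact fixRows_col hg a b hb
  rcases lt_trichotomy a b with h | rfl | h
  -- What is left has row index at least `n` and column index at most `n` (counted from 0), so it
  -- never lies above the diagonal.
  · exfalso
    have := dim_eq t n
    have := ntilde_le t n
    rw [Fin.val_rev] at hb
    rw [Fin.lt_def] at h
    omega
  · rw [hg.1.1.2, Units.val_one, Matrix.one_apply_eq]
  · rw [hg.1.1.1 _ _ h, Units.val_one, Matrix.one_apply_ne h.ne']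

/-- The elements of `U` that differ from the identity matrix only in row `i` and in the mirror
column. -/
def rowElements (t : LieType) {n : ℕ} (F : Type*) [Field F] (i : Fin n) :
    Submonoid (GL (Idx t n) F) where
  carrier := {g | g ∈ fixRows t n F i ∧ ∀ a b, a ≠ rowIdx t i → b ≠ (rowIdx t i).rev →
    g.1 a b = (1 : Matrix (Idx t n) (Idx t n) F) a b}
  one_mem' := ⟨one_mem _, fun _ _ _ _ => rfl⟩
  mul_mem' := by
    rintro g h ⟨hg, hg'⟩ ⟨hh, hh'⟩
    refine ⟨mul_mem hg hh, fun a b ha hb => ?_⟩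
    rw [Units.val_mul, Matrix.mul_apply, Finset.sum_eq_single a]
    · rw [hg.1.1.2, hh' a b ha hb, one_mul]
    · intro k _ hk
      by_cases hk' : k = (rowIdx t i).rev
      · rw [hh' k b (hk' ▸ (rowIdx_lt_rev i).ne') hb, Matrix.one_apply_ne (hk' ▸ hb.symm), mul_zero]
      · rw [hg' a k ha hk', Matrix.one_apply_ne hk.symm, zero_mul]
    · simp

variable {i : Fin n} {g h : GL (Idx t n) F}

lemma rowElements_mem_U (hg : g ∈ rowElements t F i) : g ∈ U t n F := hg.1.1

lemma inv_mem_rowElements [Finite F] (hg : g ∈ rowElements t F i) : g⁻¹ ∈ rowElements t F i :=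
  Submonoid.inv_mem_of_finite _ hg

lemma rowElements_apply_left (hg : g ∈ rowElements t F i) {j : Idx t n} (h : j < rowIdx t i) :
    g.1 (rowIdx t i) j = 0 := (rowElements_mem_U hg).1.1 _ _ h

lemma rowElements_apply_right (hg : g ∈ rowElements t F i) {j : Idx t n}
    (h : (rowIdx t i).rev < j) : g.1 (rowIdx t i) j = 0 := by
  have h1 : j.rev < rowIdx t i := by rwa [← Fin.rev_lt_rev, Fin.rev_rev]
  rw [fixRows_col hg.1 _ _ h1, Matrix.one_apply_ne ((rowIdx_lt_rev i).trans h).ne]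

/-- Column `j` of `h` is trivial outside row `i`, so entries of row `i` simply add. The corner must
be excluded: column `ī` is in general non-trivial, and quadratic terms appear there. -/
lemma rowElements_mul_apply (hg : g ∈ rowElements t F i) (hh : h ∈ rowElements t F i)
    {j : Idx t n} (hj : j ≠ rowIdx t i) (hj' : j ≠ (rowIdx t i).rev) :
    (g * h).1 (rowIdx t i) j = g.1 (rowIdx t i) j + h.1 (rowIdx t i) j := by
  rw [Units.val_mul, Matrix.mul_apply, Finset.sum_eq_add (rowIdx t i) j hj.symm]
  · rw [(rowElements_mem_U hg).1.2, (rowElements_mem_U hh).1.2, one_mul, mul_one, add_comm]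
  · intro k _ hk
    rw [hh.2 k j hk.1 hj', Matrix.one_apply_ne hk.2, mul_zero]
  · simp
  · simp

lemma rowElements_list_prod_apply {ι : Type*} (l : List ι) (f : ι → GL (Idx t n) F)
    (hf : ∀ k, f k ∈ rowElements t F i)
    {j : Idx t n} (hj : j ≠ rowIdx t i) (hj' : j ≠ (rowIdx t i).rev) :
    (l.map f).prod.1 (rowIdx t i) j = (l.map fun k => (f k).1 (rowIdx t i) j).sum := by
  induction l with
  | nil => simp [Matrix.one_apply_ne hj.symm]
  | cons k l ih =>
    rw [List.map_cons, List.prod_cons, rowElements_mul_apply (hf k) _ hj hj', ih, List.map_cons,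
      List.sum_cons]
    refine Submonoid.list_prod_mem _ fun y hy => ?_
    obtain ⟨k, -, rfl⟩ := List.mem_map.1 hy
    exact hf k

lemma rowElements_inv_apply [Finite F] (hg : g ∈ rowElements t F i)
    {j : Idx t n} (hj : j ≠ rowIdx t i) (hj' : j ≠ (rowIdx t i).rev) :
    (g⁻¹).1 (rowIdx t i) j = -g.1 (rowIdx t i) j := by
  have := rowElements_mul_apply hg (inv_mem_rowElements hg) hj hj'
  rw [mul_inv_cancel, Units.val_one, Matrix.one_apply_ne hj.symm] at this
  exact (neg_eq_of_add_eq_zero_right this.symm).symm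

/-- Inversion both negates the entry `(i,j)` and reflects the matrix, so the entries at `(i,j)` and
`(j̄,ī)` agree up to sign. -/
lemma rowElements_apply_eq_zero_iff [Finite F] (hg : g ∈ rowElements t F i)
    {j : Idx t n} (hj : j ≠ rowIdx t i) (hj' : j ≠ (rowIdx t i).rev) :
    g.1 j.rev (rowIdx t i).rev = 0 ↔ g.1 (rowIdx t i) j = 0 := by
  have h := inv_apply_eq (rowElements_mem_U hg) (rowIdx t i) j
  rw [rowElements_inv_apply hg hj hj'] at h
  constructor <;> intro h1
  · rw [h1, mul_zero, mul_neg, neg_eq_zero] at h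
    exact (mul_eq_zero.1 h).resolve_left (gramSign_ne_zero _)
  · rw [h1, neg_zero, mul_zero] at h
    exact (mul_eq_zero.1 h.symm).resolve_left (gramSign_ne_zero _)

lemma rowElements_eq_one (hg : g ∈ rowElements t F i)
    (h : ∀ j, g.1 (rowIdx t i) j = (1 : Matrix (Idx t n) (Idx t n) F) (rowIdx t i) j) :
    g = 1 := by
  refine Units.ext (Matrix.ext fun a b => ?_)
  by_cases ha : a = rowIdx t i
  · rw [ha]
    exact h b
  by_cases hb : b = (rowIdx t i).rev
  · rw [hb]
    exact col_eq_of_row_eq (rowElements_mem_U hg) h a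
  · exact hg.2 a b ha hb

lemma rowElements_ext_row [Finite F] (hg : g ∈ rowElements t F i) (hh : h ∈ rowElements t F i)
    (e : ∀ j, g.1 (rowIdx t i) j = h.1 (rowIdx t i) j) : g = h := by
  refine mul_inv_eq_one.1
    (rowElements_eq_one (mul_mem hg (inv_mem_rowElements hh)) fun j => ?_)
  have h1 : (h.1 * (h⁻¹).1) (rowIdx t i) j = (1 : Matrix (Idx t n) (Idx t n) F) (rowIdx t i) j := by
    rw [← Units.val_mul, mul_inv_cancel, Units.val_one]
  rw [← h1, Units.val_mul, Matrix.mul_apply, Matrix.mul_apply]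
  simp only [e]

/-- A row element is determined by the entries of its row in the columns of `pUP`. -/
lemma rowElements_ext [Finite F] (hF : ringChar F ≠ 2)
    (hg : g ∈ rowElements t F i) (hh : h ∈ rowElements t F i)
    (e : ∀ j, rowIdx t i < j → j < (rowIdx t i).rev → g.1 (rowIdx t i) j = h.1 (rowIdx t i) j)
    (eC : t = .C → g.1 (rowIdx t i) (rowIdx t i).rev = h.1 (rowIdx t i) (rowIdx t i).rev) :
    g = h := by
  by_cases ht : t = .C
  · refine rowElements_ext_row hg hh fun j => ?_
    rcases lt_trichotomy j (rowIdx t i) with hj | rfl | hj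
    · rw [rowElements_apply_left hg hj, rowElements_apply_left hh hj]
    · rw [(rowElements_mem_U hg).1.2, (rowElements_mem_U hh).1.2]
    rcases lt_trichotomy j (rowIdx t i).rev with hj' | rfl | hj'
    · exact e j hj hj'
    · exact eC ht
    · rw [rowElements_apply_right hg hj', rowElements_apply_right hh hj']
  -- In types `B` and `D` the corner is not prescribed. The quotient `g h⁻¹` has a trivial row off
  -- the corner, and `corner_eq_zero` does the rest.
  · have hm := mul_mem hg (inv_mem_rowElements hh)
    have h0 : ∀ j, j ≠ rowIdx t i → j ≠ (rowIdx t i).rev →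
        (g * h⁻¹).1 (rowIdx t i) j = 0 := by
      intro j hj hj'
      rcases lt_or_gt_of_ne hj with h1 | h1
      · exact rowElements_apply_left hm h1
      rcases lt_or_gt_of_ne hj' with h2 | h2
      · rw [rowElements_mul_apply hg (inv_mem_rowElements hh) hj hj',
          rowElements_inv_apply hh hj hj', e j h1 h2, add_neg_cancel]
      · exact rowElements_apply_right hm h2
    refine mul_inv_eq_one.1 (rowElements_eq_one hm fun j => ?_)
    by_cases hj : j = rowIdx t i
    · rw [hj, (rowElements_mem_U hm).1.2, Matrix.one_apply_eq]
    rw [Matrix.one_apply_ne (Ne.symm hj)]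
    by_cases hj' : j = (rowIdx t i).rev
    · rw [hj']
      exact corner_eq_zero hF ht (rowElements_mem_U hm) (rowIdx_lt_rev i).ne h0
    · exact h0 j hj hj'

lemma x_mem_rowElements (hF : ringChar F ≠ 2) {j : Idx t n} (h : (rowIdx t i, j) ∈ pUP t n)
    (α : F) : x t n (rowIdx t i) j α ∈ rowElements t F i :=
  ⟨⟨x_mem_U hF h α, fun _ _ ha => x_row_of_ne h α ha⟩, fun _ _ ha hb => x_apply_of_ne h α ha hb⟩

open Classical in
lemma xRow_factor_mem (hF : ringChar F ≠ 2) (α : RowCols t n (rowIdx t i) → F) (j : Idx t n) :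
    (if h : (rowIdx t i, j) ∈ pUP t n then x t n (rowIdx t i) j (α ⟨j, h⟩) else 1) ∈
      rowElements t F i := by
  split_ifs with h
  · exact x_mem_rowElements hF h _
  · exact one_mem _

lemma xRow_mem_rowElements (hF : ringChar F ≠ 2) (α : RowCols t n (rowIdx t i) → F) :
    xRow (rowIdx t i) α ∈ rowElements t F i := by
  refine Submonoid.list_prod_mem _ fun y hy => ?_
  obtain ⟨k, -, rfl⟩ := List.mem_map.1 hy
  exact xRow_factor_mem hF α k

lemma xRow_mem_rowGroup (α : RowCols t n (rowIdx t i) → F) :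
    xRow (rowIdx t i) α ∈ rowGroup t n F (rowIdx t i) := by
  refine Subgroup.list_prod_mem _ fun y hy => ?_
  obtain ⟨k, -, rfl⟩ := List.mem_map.1 hy
  split_ifs with h
  · exact Subgroup.subset_closure ⟨k, h, _, rfl⟩
  · exact one_mem _

lemma xRow_apply (hF : ringChar F ≠ 2) (α : RowCols t n (rowIdx t i) → F)
    (j : RowCols t n (rowIdx t i)) (hj' : j.1 ≠ (rowIdx t i).rev) :
    (xRow (rowIdx t i) α).1 (rowIdx t i) j = α j := by
  have hj : j.1 ≠ rowIdx t i := (lt_of_mem_pUP j.2).ne'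
  rw [xRow, rowElements_list_prod_apply _ _ (xRow_factor_mem hF α) hj hj', ← List.ofFn_eq_map,
    List.sum_ofFn, Finset.sum_eq_single j.1]
  · rw [dif_pos j.2, x_apply_row j.2 _ hj hj', if_pos rfl]
  · intro k _ hk
    split_ifs with h
    · rw [x_apply_row h _ hj hj', if_neg hk.symm]
    · exact Matrix.one_apply_ne hj.symm
  · simp

lemma _root_.List.prod_map_eq_mul_of_commute {ι M : Type*} [Monoid M] {l : List ι} (hl : l.Nodup)
    {j : ι} (hj : j ∈ l) {f f' : ι → M} {z : M} (hz : ∀ k, Commute z (f k))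
    (hfj : f' j = f j * z) (hf : ∀ k, k ≠ j → f' k = f k) :
    (l.map f').prod = (l.map f).prod * z := by
  induction l with
  | nil => simp at hj
  | cons k l ih =>
    rw [List.nodup_cons] at hl
    rw [List.map_cons, List.map_cons, List.prod_cons, List.prod_cons]
    rcases List.mem_cons.1 hj with rfl | hj
    · have h1 : l.map f' = l.map f :=
        List.map_congr_left fun k hk => hf k (by rintro rfl; exact hl.1 hk)
      have h2 : Commute z (l.map f).prod := by
        refine Commute.list_prod_right _ _ fun y hy => ?_
        obtain ⟨k, -, rfl⟩ := List.mem_map.1 hy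
        exact hz k
      rw [h1, hfj, mul_assoc, h2.eq, mul_assoc]
    · rw [ih hl.2 hj, hf k (by rintro rfl; exact hl.1 hj), mul_assoc]

lemma mem_pUP_rev_of_C (i : Fin n) : (rowIdx .C i, (rowIdx .C i).rev) ∈ pUP .C n :=
  mem_pUP_iff.2 ⟨rowIdx_lt_rev i, Or.inr ⟨rfl, rfl⟩⟩

lemma coe_x_rev (c : F) : (x .C n (rowIdx .C i) (rowIdx .C i).rev c).1 =
    1 + single (rowIdx .C i) (rowIdx .C i).rev c := by
  rw [coe_x (mem_pUP_rev_of_C i), rootMatrix, if_pos rfl]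

lemma coe_x_rev_apply (c : F) (j : Idx .C n) :
    (x .C n (rowIdx .C i) (rowIdx .C i).rev c).1 (rowIdx .C i) j =
      (1 : Matrix (Idx .C n) (Idx .C n) F) (rowIdx .C i) j +
        if j = (rowIdx .C i).rev then c else 0 := by
  rw [coe_x_rev, Matrix.add_apply, single_apply]
  simp [eq_comm]

/-- Column `i` and row `ī` of a row element are trivial, so multiplying `e_{iī}` by it on either
side changes nothing. -/
lemma commute_x_rev {g : GL (Idx .C n) F} (hg : g ∈ rowElements .C F i) (c : F) :
    Commute (x .C n (rowIdx .C i) (rowIdx .C i).rev c) g := by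
  refine Units.ext ?_
  rw [Units.val_mul, Units.val_mul, coe_x_rev, add_mul, mul_add, one_mul, mul_one]
  congr 1
  ext a b
  have h1 : ∀ b, g.1 (rowIdx .C i).rev b =
      (1 : Matrix (Idx .C n) (Idx .C n) F) (rowIdx .C i).rev b := by
    intro b
    by_cases hb : b = (rowIdx .C i).rev
    · rw [hb, (rowElements_mem_U hg).1.2, Matrix.one_apply_eq]
    · exact hg.2 _ _ (rowIdx_lt_rev i).ne' hb
  have h2 : ∀ a, g.1 a (rowIdx .C i) =
      (1 : Matrix (Idx .C n) (Idx .C n) F) a (rowIdx .C i) := by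
    intro a
    by_cases ha : a = rowIdx .C i
    · rw [ha, (rowElements_mem_U hg).1.2, Matrix.one_apply_eq]
    · exact hg.2 _ _ ha (rowIdx_lt_rev i).ne
  by_cases ha : a = rowIdx .C i
  · by_cases hb : b = (rowIdx .C i).rev
    · simp [ha, hb, h1, h2]
    · simp [ha, h1, hb, Matrix.one_apply_ne (Ne.symm hb)]
  · by_cases hb : b = (rowIdx .C i).rev
    · simp [ha, hb, h2]
    · simp [ha, hb]

/-- In type `C`, the corner entry of `xRow` can be prescribed. -/
lemma xRow_add_corner (hF : ringChar F ≠ 2) (α : RowCols .C n (rowIdx .C i) → F) (c : F) :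
    (xRow (rowIdx .C i) fun j => if j.1 = (rowIdx .C i).rev then α j + c else α j) =
      xRow (rowIdx .C i) α * x .C n (rowIdx .C i) (rowIdx .C i).rev c := by
  refine List.prod_map_eq_mul_of_commute (List.nodup_finRange _)
    (List.mem_finRange (rowIdx .C i).rev)
    (fun k => commute_x_rev (xRow_factor_mem hF α k) c) ?_ fun k hk => ?_
  · rw [dif_pos (mem_pUP_rev_of_C i), dif_pos (mem_pUP_rev_of_C i)]
    dsimp only
    rw [if_pos rfl]
    refine Units.ext ?_
    rw [Units.val_mul, coe_x_rev, coe_x_rev, coe_x_rev, add_mul, one_mul, mul_add, mul_one,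
      single_mul_single_of_ne _ _ _ _ (rowIdx_lt_rev i).ne', single_add]
    abel
  · simp [hk]

/-- The entries of a row element in the columns of `pUP` can be prescribed. -/
lemma exists_xRow_apply (hF : ringChar F ≠ 2) (i : Fin n) (v : Idx t n → F) :
    ∃ α : RowCols t n (rowIdx t i) → F,
      (∀ j : RowCols t n (rowIdx t i), j.1 ≠ (rowIdx t i).rev → α j = v j) ∧
      (t = .C → (xRow (rowIdx t i) α).1 (rowIdx t i) (rowIdx t i).rev = v (rowIdx t i).rev) := by
  by_cases ht : t = .C
  · subst ht
    have h0 := xRow_mem_rowElements (i := i) hF (fun j => v j.1)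
    -- The product formed from `v` has the right entries except perhaps in the corner. The corner
    -- parameter contributes a central factor, so adding the defect to it shifts the corner by
    -- exactly that amount.
    refine ⟨fun j => if j.1 = (rowIdx .C i).rev then v j +
      (v j - (xRow (rowIdx .C i) (fun j => v j.1)).1 (rowIdx .C i) (rowIdx .C i).rev)
      else v j, fun j hj => if_neg hj, fun _ => ?_⟩
    have h1 := xRow_add_corner (i := i) hF (fun j => v j.1) (v (rowIdx .C i).rev -
      (xRow (rowIdx .C i) (fun j => v j.1)).1 (rowIdx .C i) (rowIdx .C i).rev)
    have h2 : ∀ c : F, (fun j : RowCols .C n (rowIdx .C i) =>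
        if j.1 = (rowIdx .C i).rev then v j + (v j - c) else v j) =
        fun j : RowCols .C n (rowIdx .C i) =>
          if j.1 = (rowIdx .C i).rev then v j + (v (rowIdx .C i).rev - c) else v j := by
      intro c
      funext j
      split_ifs with h
      · rw [h]
      · rfl
    rw [h2, h1, ← (commute_x_rev h0 _).eq, Units.val_mul, coe_x_rev, add_mul, one_mul,
      Matrix.add_apply, single_mul_apply_same, (rowElements_mem_U h0).1.2]
    ring
  · exact ⟨fun j => v j, fun _ _ => rfl, fun h => absurd h ht⟩

lemma exists_xRow_eq [Finite F] (hF : ringChar F ≠ 2) (hg : g ∈ rowElements t F i) :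
    ∃ α : RowCols t n (rowIdx t i) → F, g = xRow (rowIdx t i) α := by
  obtain ⟨α, h1, h2⟩ := exists_xRow_apply hF i (fun j => g.1 (rowIdx t i) j)
  refine ⟨α, rowElements_ext hF hg (xRow_mem_rowElements hF α) (fun j hj hj' => ?_)
    fun ht => (h2 ht).symm⟩
  have hm : (rowIdx t i, j) ∈ pUP t n := mem_pUP_iff.2 ⟨hj, Or.inl hj'⟩
  rw [xRow_apply hF α ⟨j, hm⟩ hj'.ne, h1 ⟨j, hm⟩ hj'.ne]

/-- Replaces generators by a condition on matrix entries; the nontrivial inclusion holds because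
every row element is a single ordered product `xRow`. -/
lemma mem_rowGroup_iff [Finite F] (hF : ringChar F ≠ 2) :
    g ∈ rowGroup t n F (rowIdx t i) ↔ g ∈ rowElements t F i := by
  refine ⟨fun hg => ?_, fun hg => ?_⟩
  · induction hg using Subgroup.closure_induction with
    | mem y hy =>
      obtain ⟨j, hj, α, rfl⟩ := hy
      exact x_mem_rowElements hF hj α
    | one => exact one_mem _
    | mul y z _ _ hy hz => exact mul_mem hy hz
    | inv y _ hy => exact inv_mem_rowElements hy
  · obtain ⟨α, rfl⟩ := exists_xRow_eq hF hg
    exact xRow_mem_rowGroup α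

lemma rowElements_inter_fixRows (hg : g ∈ rowElements t F i) (hg' : g ∈ fixRows t n F (i + 1)) :
    g = 1 :=
  rowElements_eq_one hg fun j => hg'.2 _ j (Nat.lt_succ_self _)

lemma fixRows_decomposition [Finite F] (hF : ringChar F ≠ 2) (hg : g ∈ fixRows t n F i) :
    ∃ y ∈ rowElements t F i, ∃ w ∈ fixRows t n F (i + 1), g = y * w := by
  -- If row `i` of `y` is row `i` of `g⁻¹`, then row `i` of `y g` is trivial. The entries can be
  -- matched directly except for the corner in types `B` and `D`; `d` below measures that defect.
  obtain ⟨α, h1, h2⟩ := exists_xRow_apply hF i (fun j => (g⁻¹).1 (rowIdx t i) j)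
  have hy := xRow_mem_rowElements hF α
  have hx := xRow_apply hF α
  set y := xRow (rowIdx t i) α with hy'
  have hgi : g⁻¹ ∈ fixRows t n F i := Submonoid.inv_mem_of_finite _ hg
  have hwi : y * g ∈ fixRows t n F i := mul_mem hy.1 hg
  set d := y.1 (rowIdx t i) (rowIdx t i).rev - (g⁻¹).1 (rowIdx t i) (rowIdx t i).rev with hd
  have hrow : ∀ k, y.1 (rowIdx t i) k = (g⁻¹).1 (rowIdx t i) k +
      if k = (rowIdx t i).rev then d else 0 := by
    intro k
    rcases lt_trichotomy k (rowIdx t i) with hk | rfl | hk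
    · rw [rowElements_apply_left hy hk, hgi.1.1.1 _ _ hk,
        if_neg (hk.trans (rowIdx_lt_rev i)).ne, add_zero]
    · rw [(rowElements_mem_U hy).1.2, hgi.1.1.2, if_neg (rowIdx_lt_rev i).ne, add_zero]
    rcases lt_trichotomy k (rowIdx t i).rev with hk' | rfl | hk'
    · have hm : (rowIdx t i, k) ∈ pUP t n := mem_pUP_iff.2 ⟨hk, Or.inl hk'⟩
      rw [hx ⟨k, hm⟩ hk'.ne, h1 ⟨k, hm⟩ hk'.ne, if_neg hk'.ne, add_zero]
    · rw [if_pos rfl, hd]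
      ring
    · have h3 : k.rev < rowIdx t i := by rwa [← Fin.rev_lt_rev, Fin.rev_rev]
      rw [rowElements_apply_right hy hk', if_neg hk'.ne', fixRows_col hgi _ _ h3,
        Matrix.one_apply_ne hk.ne, add_zero]
  have hrev : ∀ j, g.1 (rowIdx t i).rev j =
      (1 : Matrix (Idx t n) (Idx t n) F) (rowIdx t i).rev j := by
    intro j
    rcases lt_trichotomy j (rowIdx t i).rev with hj | rfl | hj
    · rw [hg.1.1.1 _ _ hj, Matrix.one_apply_ne hj.ne']
    · rw [hg.1.1.2, Matrix.one_apply_eq]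
    · have h3 : j.rev < rowIdx t i := by rwa [← Fin.rev_lt_rev, Fin.rev_rev]
      exact fixRows_col hg _ _ h3
  have hw : ∀ j, (y * g).1 (rowIdx t i) j =
      (1 : Matrix (Idx t n) (Idx t n) F) (rowIdx t i) j +
        if j = (rowIdx t i).rev then d else 0 := by
    intro j
    have h3 : ((g⁻¹).1 * g.1) (rowIdx t i) j =
        (1 : Matrix (Idx t n) (Idx t n) F) (rowIdx t i) j := by
      rw [← Units.val_mul, inv_mul_cancel, Units.val_one]
    rw [← h3, Units.val_mul, Matrix.mul_apply, Matrix.mul_apply]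
    simp only [hrow, add_mul, Finset.sum_add_distrib, ite_mul, zero_mul, Finset.sum_ite_eq',
      Finset.mem_univ, if_true, hrev]
    congr 1
    by_cases hj : j = (rowIdx t i).rev
    · rw [if_pos hj, hj, Matrix.one_apply_eq, mul_one]
    · simp [hj, Matrix.one_apply_ne (Ne.symm hj)]
  have hd0 : d = 0 := by
    by_cases ht : t = .C
    · rw [hd, h2 ht, sub_self]
    -- Off the corner, row `i` of the isometry `y g` is already trivial, so its corner entry `d`
    -- vanishes too.
    · have := corner_eq_zero hF ht hwi.1 (rowIdx_lt_rev i).ne (fun j hj hj' => by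
        rw [hw, Matrix.one_apply_ne (Ne.symm hj), if_neg hj', add_zero])
      rwa [hw, Matrix.one_apply_ne (rowIdx_lt_rev i).ne, if_pos rfl, zero_add] at this
  refine ⟨y⁻¹, inv_mem_rowElements hy, y * g, ⟨hwi.1, fun a b ha => ?_⟩,
    (inv_mul_cancel_left y g).symm⟩
  rcases Nat.lt_succ_iff_lt_or_eq.1 ha with ha | ha
  · exact hwi.2 a b ha
  · obtain rfl : a = rowIdx t i := Fin.ext ha
    rw [hw, hd0, ite_self, add_zero]

end RowElements

/-! ### The stabilizer as a matrix condition, and splitting off one row factor. -/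

section Stabilizer

variable {F : Type*} [Field F] {t : LieType} {n : ℕ}

lemma mem_pUP_of_le {a b l : Idx t n} (hab : a < b) (hbl : b ≤ l) (h : (a, l) ∈ pUP t n) :
    (a, b) ∈ pUP t n := by
  rw [mem_pUP_iff] at h ⊢
  refine ⟨hab, ?_⟩
  rcases hbl.lt_or_eq with hbl | rfl
  · rcases h.2 with h | ⟨-, rfl⟩
    · exact Or.inl (hbl.trans h)
    · exact Or.inl hbl
  · exact h.2

lemma V_apply_eq_zero (A : V t n F) {a b : Idx t n} (h : (a, b) ∉ pUP t n) : A.1 a b = 0 :=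
  A.2 a b h

/-- Entries of `A gᵀ` at positions above the diagonal but outside of `pUP` vanish. -/
lemma sum_eq_zero_of_notMem (A : V t n F) {g : GL (Idx t n) F} (hg : g ∈ U t n F)
    {a b : Idx t n} (hab : a < b) (h : (a, b) ∉ pUP t n) : ∑ k, A.1 a k * g.1 b k = 0 := by
  refine Finset.sum_eq_zero fun k _ => ?_
  rcases lt_or_ge k b with hk | hk
  · rw [hg.1.1 _ _ hk, mul_zero]
  · rw [V_apply_eq_zero A fun h' => h (mem_pUP_of_le hab hk h'), zero_mul]

/-- The elements `g` of `U` such that `A gᵀ` agrees with `A` above the diagonal. -/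
def fixMat (A : V t n F) : Submonoid (GL (Idx t n) F) where
  carrier := {g | g ∈ U t n F ∧ ∀ a b, a < b → ∑ k, A.1 a k * g.1 b k = A.1 a b}
  one_mem' := ⟨one_mem _, fun a b _ => by simp [Matrix.one_apply]⟩
  mul_mem' := by
    rintro g h ⟨hg, hg'⟩ ⟨hh, hh'⟩
    refine ⟨mul_mem hg hh, fun a b hab => ?_⟩
    rw [← hg' a b hab]
    simp only [Units.val_mul, Matrix.mul_apply, Finset.mul_sum]
    rw [Finset.sum_comm]
    refine Finset.sum_congr rfl fun l _ => ?_
    -- For `l ≥ b > a` the position `(a,l)` is still above the diagonal, so the condition on `h`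
    -- applies. This is why the condition is not restricted to `pUP`.
    rcases lt_or_ge l b with hl | hl
    · simp [hg.1.1 _ _ hl]
    · rw [← hh' a l (hab.trans_le hl), Finset.sum_mul]
      exact Finset.sum_congr rfl fun k _ => by ring

lemma kappa_eq_sum (A B : Matrix (Idx t n) (Idx t n) F) :
    kappa A B = ∑ a, ∑ b, A a b * B a b := by
  rw [kappa, Matrix.trace, Finset.sum_comm]
  rfl

lemma kappa_proj (A : V t n F) (B : Matrix (Idx t n) (Idx t n) F) :
    kappa A.1 (proj t n F B).1 = kappa A.1 B := by
  rw [kappa_eq_sum, kappa_eq_sum]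
  refine Finset.sum_congr rfl fun a _ => Finset.sum_congr rfl fun b _ => ?_
  by_cases h : (a, b) ∈ pUP t n
  · simp [proj, h]
  · rw [V_apply_eq_zero A h, zero_mul, zero_mul]

lemma kappa_mul (A B M : Matrix (Idx t n) (Idx t n) F) :
    kappa A (B * M) = kappa (A * Mᵀ) B := by
  rw [kappa, kappa, Matrix.transpose_mul, Matrix.transpose_transpose, ← Matrix.mul_assoc,
    Matrix.trace_mul_comm, Matrix.mul_assoc]

/-- The projection is invisible to `A`, which vanishes outside `pUP`; the factor `g⁻¹` then moves to
the other side of the trace form. -/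
lemma charDot_bracket_apply (θ : AddChar F ℂ) (A B : V t n F) (g : GL (Idx t n) F) :
    charDot (bracket θ A) g B = θ (-kappa (A.1 * ((g⁻¹).1)ᵀ) B.1) := by
  change θ (kappa (-A : V t n F).1 (proj t n F (B.1 * (g⁻¹).1)).1) = _
  rw [kappa_proj, kappa_mul]
  congr 1
  simp [kappa]

lemma mem_Stab_iff [Finite F] {θ : AddChar F ℂ} (hθ : θ ≠ 1) {A : V t n F} {g : GL (Idx t n) F} :
    g ∈ Stab θ A ↔ g ∈ fixMat A := by
  have hb : ∀ B, bracket θ A B = θ (-kappa A.1 B.1) := fun B => by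
    change θ (kappa (-A : V t n F).1 B.1) = _
    simp [kappa]
  have key : ∀ g : GL (Idx t n) F, g⁻¹ ∈ fixMat A ↔ g ∈ Stab θ A := by
    intro g
    refine ⟨fun h => ⟨inv_mem_iff.1 h.1, ?_⟩, fun h => ⟨inv_mem h.1, fun a b hab => ?_⟩⟩
    · ext B
      rw [charDot_bracket_apply, hb, kappa_eq_sum, kappa_eq_sum]
      congr 2
      refine Finset.sum_congr rfl fun a _ => Finset.sum_congr rfl fun b _ => ?_
      by_cases hab : (a, b) ∈ pUP t n
      · rw [← h.2 a b (lt_of_mem_pUP hab)]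
        rfl
      · rw [V_apply_eq_zero B hab, mul_zero, mul_zero]
    · by_cases hm : (a, b) ∈ pUP t n
      · by_contra hne
        -- Suppose the entries differ by `d ≠ 0`. Testing both characters on the elementary matrix
        -- scaled by `-c/d` gives `θ c = 1` for every `c`, so `θ` would be trivial.
        refine hθ (DFunLike.ext _ _ fun c => ?_)
        set d := ∑ k, A.1 a k * (g⁻¹).1 b k - A.1 a b with hd
        have hd0 : d ≠ 0 := sub_ne_zero.2 hne
        have hB : single a b (-(c / d)) ∈ V t n F := fun i j hij => by
          rw [single_apply_of_ne]
          rintro ⟨rfl, rfl⟩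
          exact hij hm
        have h1 := DFunLike.congr_fun h.2 ⟨_, hB⟩
        have hk : ∀ M : Matrix (Idx t n) (Idx t n) F,
            kappa M (single a b (-(c / d))) = -(M a b * (c / d)) := by
          intro M
          rw [kappa_eq_sum, Finset.sum_eq_single a, Finset.sum_eq_single b]
          · simp
          · intro j _ hj
            simp [hj.symm]
          · simp
          · intro j _ hj
            simp [hj.symm]
          · simp
        rw [charDot_bracket_apply, hb, hk, hk, neg_neg, neg_neg] at h1
        have h2 : (A.1 * ((g⁻¹).1)ᵀ) a b = d + A.1 a b := by
          rw [hd, sub_add_cancel]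
          rfl
        have h3 : (d + A.1 a b) * (c / d) = c + A.1 a b * (c / d) := by
          field_simp
        rw [h2, h3, AddChar.map_add_eq_mul] at h1
        exact (mul_eq_right₀ (AddChar.val_isUnit θ _).ne_zero).1 h1
      · rw [V_apply_eq_zero A hm]
        exact sum_eq_zero_of_notMem A (inv_mem h.1) hab hm
  rw [← key]
  refine ⟨fun h => Submonoid.inv_mem_of_finite _ h, fun h => ?_⟩
  have := Submonoid.inv_mem_of_finite _ h
  exact this

variable {A : V t n F} {i : Fin n}

/-- Right multiplication of a row element by an element of the following rows. -/
lemma rowElements_mul_apply_of_ne {y w : GL (Idx t n) F} (hy : y ∈ rowElements t F i)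
    (hw : w ∈ fixRows t n F (i + 1)) {b : Idx t n} (hb : b ≠ rowIdx t i) (k : Idx t n) :
    (y * w).1 b k = w.1 b k + if k = (rowIdx t i).rev then
      y.1 b (rowIdx t i).rev - (1 : Matrix (Idx t n) (Idx t n) F) b (rowIdx t i).rev else 0 := by
  have h1 : ∀ l, y.1 b l = (1 : Matrix (Idx t n) (Idx t n) F) b l +
      if l = (rowIdx t i).rev then
        y.1 b (rowIdx t i).rev - (1 : Matrix (Idx t n) (Idx t n) F) b (rowIdx t i).rev else 0 := by
    intro l
    split_ifs with hl
    · rw [hl]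
      ring
    · rw [hy.2 b l hb hl, add_zero]
  have h2 : w.1 (rowIdx t i).rev k = (1 : Matrix (Idx t n) (Idx t n) F) (rowIdx t i).rev k := by
    rcases lt_trichotomy k (rowIdx t i).rev with hk | rfl | hk
    · rw [hw.1.1.1 _ _ hk, Matrix.one_apply_ne hk.ne']
    · rw [hw.1.1.2, Matrix.one_apply_eq]
    · refine fixRows_col hw _ _ (Nat.lt_succ_of_lt ?_)
      have h3 : k.rev < rowIdx t i := by rwa [← Fin.rev_lt_rev, Fin.rev_rev]
      exact h3
  rw [Units.val_mul, Matrix.mul_apply]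
  generalize y.1 b (rowIdx t i).rev -
    (1 : Matrix (Idx t n) (Idx t n) F) b (rowIdx t i).rev = c at h1 ⊢
  simp only [h1, add_mul, Finset.sum_add_distrib, ite_mul, zero_mul, Finset.sum_ite_eq',
    Finset.mem_univ, if_true, h2]
  congr 1
  · rw [← Matrix.mul_apply, one_mul]
  · by_cases hk : k = (rowIdx t i).rev
    · rw [if_pos hk, hk, Matrix.one_apply_eq, mul_one]
    · simp [hk, Matrix.one_apply_ne (Ne.symm hk)]

lemma sum_mul_apply_of_ne (A : V t n F) {y w : GL (Idx t n) F} (hy : y ∈ rowElements t F i)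
    (hw : w ∈ fixRows t n F (i + 1)) (a : Idx t n) {b : Idx t n} (hb : b ≠ rowIdx t i) :
    ∑ k, A.1 a k * (y * w).1 b k = ∑ k, A.1 a k * w.1 b k + A.1 a (rowIdx t i).rev *
      (y.1 b (rowIdx t i).rev - (1 : Matrix (Idx t n) (Idx t n) F) b (rowIdx t i).rev) := by
  simp only [rowElements_mul_apply_of_ne hy hw hb, mul_add, Finset.sum_add_distrib, mul_ite,
    mul_zero, Finset.sum_ite_eq', Finset.mem_univ, if_true]

lemma sum_apply_of_ne (A : V t n F) {y : GL (Idx t n) F} (hy : y ∈ rowElements t F i)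
    (a : Idx t n) {b : Idx t n} (hb : b ≠ rowIdx t i) :
    ∑ k, A.1 a k * y.1 b k = A.1 a b + A.1 a (rowIdx t i).rev *
      (y.1 b (rowIdx t i).rev - (1 : Matrix (Idx t n) (Idx t n) F) b (rowIdx t i).rev) := by
  have := sum_mul_apply_of_ne A hy (one_mem (fixRows t n F (i + 1))) a hb
  rw [mul_one] at this
  rw [this]
  simp [Matrix.one_apply]

lemma apply_rev_eq_zero_of_lt (A : V t n F) {a : Idx t n} (h : rowIdx t i < a) :
    A.1 a (rowIdx t i).rev = 0 := by
  refine V_apply_eq_zero A fun h' => ?_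
  rcases (mem_pUP_iff.1 h').2 with h1 | ⟨-, h1⟩
  · exact lt_asymm h (Fin.rev_lt_rev.1 h1)
  · exact h.ne (Fin.rev_injective h1)

/-- If the column mirror to `i` of `A` is zero, then the stabilizer conditions of a row element
are those in column `i`. -/
lemma mem_fixMat_iff_of_col_eq_zero (hA : ∀ a, A.1 a (rowIdx t i).rev = 0)
    {y : GL (Idx t n) F} (hy : y ∈ rowElements t F i) :
    y ∈ fixMat A ↔
      ∀ a, a < rowIdx t i → ∑ k, A.1 a k * y.1 (rowIdx t i) k = A.1 a (rowIdx t i) := by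
  refine ⟨fun h a ha => h.2 a _ ha, fun h => ⟨rowElements_mem_U hy, fun a b hab => ?_⟩⟩
  by_cases hb : b = rowIdx t i
  · subst hb
    exact h a hab
  · rw [sum_apply_of_ne A hy a hb, hA, zero_mul, add_zero]

/-- Outside column `i`, the factor `y` contributes only multiples of column `ī` of `A`, which is
zero. In column `i`, the trivial row `i` of `w` makes the condition automatic. -/
lemma right_mem_fixMat_of_col_eq_zero (hA : ∀ a, A.1 a (rowIdx t i).rev = 0)
    {y w : GL (Idx t n) F} (hy : y ∈ rowElements t F i) (hw : w ∈ fixRows t n F (i + 1))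
    (h : y * w ∈ fixMat A) : w ∈ fixMat A := by
  refine ⟨hw.1, fun a b hab => ?_⟩
  by_cases hb : b = rowIdx t i
  · have : ∀ k, w.1 b k = (1 : Matrix (Idx t n) (Idx t n) F) b k := fun k =>
      hw.2 b k (by rw [hb]; exact Nat.lt_succ_self _)
    simp [this, Matrix.one_apply]
  · rw [← h.2 a b hab, sum_mul_apply_of_ne A hy hw a hb, hA, zero_mul, add_zero]

/-- In a staircase core, a non-zero entry in a column mirror to a row `i ≤ n` is a main condition,
and it is the only non-zero entry in its row to the right of column `i`. -/
lemma IsCore.apply_rev_ne_zero (hcore : IsCore A) {a : Idx t n}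
    (h : A.1 a (rowIdx t i).rev ≠ 0) :
    (a, (rowIdx t i).rev) ∈ mainc A ∧
      ∀ k, rowIdx t i < k → k ≠ (rowIdx t i).rev → A.1 a k = 0 := by
  have hsub : ∀ p ∈ supp A, p ∈ mainc A ∨ p ∈ minc A ∨ p ∈ suppl A := by
    intro p hp
    have := hcore.2 hp
    cases t <;> simp only [core, Set.mem_union] at this <;> tauto
  have hlt : ¬ (rowIdx t i).rev.val < ntilde t n := by
    have := dim_eq t n
    rw [Fin.val_rev, rowIdx_val]
    omega
  have hmain : (a, (rowIdx t i).rev) ∈ mainc A := by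
    rcases hsub (a, (rowIdx t i).rev) h with h1 | h1 | h1
    · exact h1
    -- A minor condition would place the mirror column `i` among the columns beyond `ñ`, which is
    -- impossible for `i ≤ n`.
    · exfalso
      have h2 : ntilde t n ≤ (rowIdx t i).rev.rev.val := h1.2.2
      rw [Fin.rev_rev, rowIdx_val] at h2
      have := le_ntilde t n
      omega
    · exact absurd h1.1.2 hlt
  have huniq : ∀ k, (a, k) ∈ mainc A → k = (rowIdx t i).rev := by
    intro k hk
    rcases lt_trichotomy k (rowIdx t i).rev with h1 | h1 | h1
    · exact absurd (hk.2.2 _ h1) h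
    · exact h1
    · exact absurd (hmain.2.2 _ h1) hk.2.1
  have hminc : ∀ k, (a, k) ∈ minc A → k = rowIdx t i := by
    intro k hk
    exact Fin.rev_injective (huniq _ hk.1)
  refine ⟨hmain, fun k hk hk' => ?_⟩
  by_contra hne
  rcases hsub (a, k) hne with h1 | h1 | h1
  · exact hk' (huniq k h1)
  · exact hk.ne' (hminc k h1)
  -- A supplementary position lies left of a minor condition, which in row `a` can only be `(a,i)`,
  -- or left of a left main condition, which row `a` does not have.
  · obtain ⟨-, ⟨l, hl, h2 | h2⟩, -⟩ := h1
    · exact lt_asymm hk (hminc l h2 ▸ hl)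
    · have h3 : l.val < ntilde t n := h2.2.2
      rw [huniq l h2.1] at h3
      exact hlt h3

/-- The condition at `(a,j̄)` isolates `A_{aī} y_{j̄ī} = 0`: to the right of column `i` only
`A_{aī}` is non-zero in row `a`, and column `ī` of `w` is trivial. By reflection, `y_{j̄ī} = 0`
means `y_{ij} = 0`. -/
lemma rowElements_apply_eq_zero_of_apply_rev_ne_zero [Finite F] (hcore : IsCore A) {a : Idx t n}
    (ha : a ≤ rowIdx t i) (h : A.1 a (rowIdx t i).rev ≠ 0)
    {y w : GL (Idx t n) F} (hy : y ∈ rowElements t F i) (hw : w ∈ fixRows t n F (i + 1))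
    (hyw : y * w ∈ fixMat A) {j : Idx t n} (hj : rowIdx t i < j) (hj' : j < (rowIdx t i).rev) :
    y.1 (rowIdx t i) j = 0 := by
  obtain ⟨-, hz⟩ := hcore.apply_rev_ne_zero h
  rw [← rowElements_apply_eq_zero_iff hy hj.ne' hj'.ne]
  have hb : rowIdx t i < j.rev := by rwa [← Fin.rev_lt_rev, Fin.rev_rev]
  have hb' : j.rev < (rowIdx t i).rev := Fin.rev_lt_rev.2 hj
  have h1 := hyw.2 a j.rev (ha.trans_lt hb)
  rw [hz _ hb hb'.ne, sum_mul_apply_of_ne A hy hw a hb.ne', Matrix.one_apply_ne hb'.ne, sub_zero,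
    Finset.sum_eq_zero, zero_add] at h1
  · exact (mul_eq_zero.1 h1).resolve_left h
  · intro k _
    rcases lt_or_ge k j.rev with hk | hk
    · rw [hw.1.1.1 _ _ hk, mul_zero]
    · by_cases hk' : k = (rowIdx t i).rev
      · rw [hk', fixRows_col hw _ _ (by rw [Fin.rev_rev]; exact Nat.lt_succ_self _),
          Matrix.one_apply_ne hb'.ne, mul_zero]
      · rw [hz k (hb.trans_le hk) hk', zero_mul]

lemma rowElements_apply_of_eq_zero {y : GL (Idx t n) F} (hy : y ∈ rowElements t F i)
    (h0 : ∀ j, rowIdx t i < j → j < (rowIdx t i).rev → y.1 (rowIdx t i) j = 0) :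
    ∃ c, ∀ k, y.1 (rowIdx t i) k = (1 : Matrix (Idx t n) (Idx t n) F) (rowIdx t i) k +
      if k = (rowIdx t i).rev then c else 0 := by
  refine ⟨y.1 (rowIdx t i) (rowIdx t i).rev, fun k => ?_⟩
  rcases lt_trichotomy k (rowIdx t i) with hk | rfl | hk
  · rw [rowElements_apply_left hy hk, Matrix.one_apply_ne hk.ne',
      if_neg (hk.trans (rowIdx_lt_rev i)).ne, add_zero]
  · rw [(rowElements_mem_U hy).1.2, Matrix.one_apply_eq, if_neg (rowIdx_lt_rev i).ne, add_zero]
  rw [Matrix.one_apply_ne hk.ne, zero_add]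
  rcases lt_trichotomy k (rowIdx t i).rev with hk' | rfl | hk'
  · rw [h0 k hk hk', if_neg hk'.ne]
  · rw [if_pos rfl]
  · rw [rowElements_apply_right hy hk', if_neg hk'.ne']

/-- Only the corner entry `c` of `y` is left. For `a < i` there is also a condition at `(a,i)`, and
it reads `A_{aī} c = 0`, because row `a` of `A` ends in column `ī`. -/
lemma rowElements_eq_one_of_apply_rev_ne_zero [Finite F] (hcore : IsCore A) {a : Idx t n}
    (ha : a < rowIdx t i) (h : A.1 a (rowIdx t i).rev ≠ 0)
    {y w : GL (Idx t n) F} (hy : y ∈ rowElements t F i) (hw : w ∈ fixRows t n F (i + 1))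
    (hyw : y * w ∈ fixMat A) : y = 1 := by
  have h0 := fun j =>
    rowElements_apply_eq_zero_of_apply_rev_ne_zero hcore ha.le h hy hw hyw (j := j)
  obtain ⟨c, hrow⟩ := rowElements_apply_of_eq_zero hy h0
  have h1 := hyw.2 a (rowIdx t i) ha
  have h2 : ∀ k, (y * w).1 (rowIdx t i) k =
      (1 : Matrix (Idx t n) (Idx t n) F) (rowIdx t i) k +
        c * w.1 (rowIdx t i).rev k := by
    intro k
    rw [Units.val_mul, Matrix.mul_apply]
    simp only [hrow, add_mul, Finset.sum_add_distrib, ite_mul, zero_mul, Finset.sum_ite_eq',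
      Finset.mem_univ, if_true]
    rw [← Matrix.mul_apply, one_mul, hw.2 _ _ (Nat.lt_succ_self _)]
  have h3 : ∑ k, A.1 a k * (c * w.1 (rowIdx t i).rev k) =
      A.1 a (rowIdx t i).rev * c := by
    rw [Finset.sum_eq_single (rowIdx t i).rev]
    · rw [hw.1.1.2, mul_one]
    · intro k _ hk
      rcases lt_or_gt_of_ne hk with hk | hk
      · rw [hw.1.1.1 _ _ hk, mul_zero, mul_zero]
      · rw [(hcore.apply_rev_ne_zero h).1.2.2 k hk, zero_mul]
    · simp
  simp only [h2, mul_add, Finset.sum_add_distrib, h3] at h1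
  simp only [Matrix.one_apply, mul_ite, mul_one, mul_zero, Finset.sum_ite_eq, Finset.mem_univ,
    if_true, add_eq_left] at h1
  refine rowElements_eq_one hy fun j => ?_
  rw [hrow, (mul_eq_zero.1 h1).resolve_left h, ite_self, add_zero]

/-- Row elements supported on the corner stabilize `A` if the corner is its only non-zero entry in
the mirror column. -/
lemma mem_fixMat_of_apply_eq_zero [Finite F] (hA : ∀ a, a < rowIdx t i → A.1 a (rowIdx t i).rev = 0)
    {y : GL (Idx t n) F} (hy : y ∈ rowElements t F i)
    (h0 : ∀ j, rowIdx t i < j → j < (rowIdx t i).rev → y.1 (rowIdx t i) j = 0) :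
    y ∈ fixMat A := by
  refine ⟨rowElements_mem_U hy, fun a b hab => ?_⟩
  by_cases hb : b = rowIdx t i
  · subst hb
    obtain ⟨c, hrow⟩ := rowElements_apply_of_eq_zero hy h0
    simp only [hrow, mul_add, Finset.sum_add_distrib, mul_ite,
      mul_zero, Finset.sum_ite_eq', Finset.mem_univ, if_true, hA a hab, zero_mul, add_zero]
    simp [Matrix.one_apply]
  · rw [sum_apply_of_ne A hy a hb, add_eq_left, mul_eq_zero, sub_eq_zero]
    rcases lt_or_gt_of_ne hb with h1 | h1
    · exact Or.inr (hy.1.2 b _ h1)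
    rcases lt_trichotomy b (rowIdx t i).rev with h2 | rfl | h2
    · right
      rw [Matrix.one_apply_ne h2.ne]
      have h3 : rowIdx t i < b.rev := by rwa [← Fin.rev_lt_rev, Fin.rev_rev]
      have h4 : b.rev < (rowIdx t i).rev := Fin.rev_lt_rev.2 h1
      have := (rowElements_apply_eq_zero_iff hy h3.ne' h4.ne).2 (h0 _ h3 h4)
      rwa [Fin.rev_rev] at this
    · right
      rw [(rowElements_mem_U hy).1.2, Matrix.one_apply_eq]
    · right
      rw [(rowElements_mem_U hy).1.1 _ _ h2, Matrix.one_apply_ne h2.ne']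

/-- The first row factor of an element of the stabilizer of a staircase core stabilizes it. -/
lemma left_mem_fixMat [Finite F] (hcore : IsCore A)
    {y w : GL (Idx t n) F} (hy : y ∈ rowElements t F i) (hw : w ∈ fixRows t n F (i + 1))
    (hyw : y * w ∈ fixMat A) : y ∈ fixMat A := by
  by_cases h1 : ∃ a, a < rowIdx t i ∧ A.1 a (rowIdx t i).rev ≠ 0
  · obtain ⟨a, ha, h⟩ := h1
    rw [rowElements_eq_one_of_apply_rev_ne_zero hcore ha h hy hw hyw]
    exact one_mem _
  push Not at h1
  by_cases h2 : A.1 (rowIdx t i) (rowIdx t i).rev = 0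
  · have hA : ∀ a, A.1 a (rowIdx t i).rev = 0 := by
      intro a
      rcases lt_trichotomy a (rowIdx t i) with ha | rfl | ha
      · exact h1 a ha
      · exact h2
      · exact apply_rev_eq_zero_of_lt A ha
    -- Here `w` stabilizes, so `y = (y w) w⁻¹` does as well.
    have := mul_mem hyw
      (Submonoid.inv_mem_of_finite _ (right_mem_fixMat_of_col_eq_zero hA hy hw hyw))
    rwa [mul_inv_cancel_right] at this
  · exact mem_fixMat_of_apply_eq_zero h1 hy fun j =>
      rowElements_apply_eq_zero_of_apply_rev_ne_zero hcore le_rfl h2 hy hw hyw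

end Stabilizer

/-! ### The three shapes of a row stabilizer. -/

section RowStabilizers

variable {F : Type*} [Field F] {t : LieType} {n : ℕ} {A : V t n F} {i : Fin n}

lemma mem_StabRow_iff [Finite F] (hF : ringChar F ≠ 2) {θ : AddChar F ℂ} (hθ : θ ≠ 1)
    {y : GL (Idx t n) F} :
    y ∈ StabRow θ A (rowIdx t i) ↔ y ∈ fixMat A ∧ y ∈ rowElements t F i := by
  rw [← mem_Stab_iff hθ, ← mem_rowGroup_iff hF]
  rfl

lemma mem_Limb_of_mem_limb₀ {p : Idx t n × Idx t n} (h : p ∈ limb₀ A) : p ∈ Limb A := by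
  cases t
  · exact h
  · exact Or.inl h
  · exact h

lemma mem_Limb_of_mem_limbC {A : V .C n F} {p : Idx .C n × Idx .C n} (h : p ∈ limbC A) :
    p ∈ Limb A := Or.inr h

lemma mem_limb₀_of_mem_Limb {p : Idx t n × Idx t n} (h : p ∈ Limb A) (hp : p ∈ UP t n) :
    p ∈ limb₀ A := by
  cases t
  · exact h
  · exact h.resolve_right fun h' => hp.2.ne h'.1.2
  · exact h

/-- A row whose mirror column contains a non-zero entry of a higher row is contained in `Limb`. -/
lemma rowPos_subset_Limb (hcore : IsCore A) {a : Idx t n}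
    (ha : a < rowIdx t i) (h : A.1 a (rowIdx t i).rev ≠ 0) : rowPos t n (rowIdx t i) ⊆ Limb A := by
  rintro ⟨b, j⟩ ⟨hj, hb⟩
  obtain rfl : b = rowIdx t i := hb
  have hm := (hcore.apply_rev_ne_zero h).1
  obtain ⟨h1, h2 | ⟨rfl, rfl⟩⟩ := mem_pUP_iff.1 hj
  · refine mem_Limb_of_mem_limb₀ ?_
    simp only [limb₀, Set.mem_iUnion]
    exact ⟨_, hm, Or.inl ⟨⟨h1, h2⟩, (Fin.rev_rev _).symm⟩⟩
  · refine mem_Limb_of_mem_limbC ⟨⟨h1, rfl⟩, a, ⟨hm, hm.1, ?_⟩,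
      ha.trans (rowIdx_lt_rev i), Fin.rev_lt_rev.2 ha⟩
    have := dim_eq .C n
    rw [Fin.val_rev, rowIdx_val]
    simp only [dim, ntilde] at this ⊢
    omega

lemma stabRow_eq_one [Finite F] (hF : ringChar F ≠ 2) (hcore : IsCore A)
    (hL : rowPos t n (rowIdx t i) ⊆ Limb A) {y : GL (Idx t n) F} (hfix : y ∈ fixMat A)
    (hy : y ∈ rowElements t F i) : y = 1 := by
  have hfix' : y * 1 ∈ fixMat A := by rwa [mul_one]
  by_cases h1 : ∃ a, a < rowIdx t i ∧ A.1 a (rowIdx t i).rev ≠ 0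
  · obtain ⟨a, ha, h⟩ := h1
    exact rowElements_eq_one_of_apply_rev_ne_zero hcore ha h hy (one_mem _) hfix'
  push Not at h1
  -- In type `C` the row contains `(i,ī)`, which is in no arm or leg. It enters `Limb A` only
  -- through a main condition `(a,ī)` with `a < i`, excluded by `h1`.
  have ht : t ≠ .C := by
    rintro rfl
    have hm : (rowIdx .C i, (rowIdx .C i).rev) ∈ Limb A := hL ⟨mem_pUP_rev_of_C i, rfl⟩
    rcases hm with hm | ⟨-, a, ha, ha'⟩
    · simp only [limb₀, Set.mem_iUnion] at hm
      obtain ⟨p, -, hp | hp⟩ := hm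
      · exact hp.1.2.ne rfl
      · exact hp.1.2.ne rfl
    · exact ha.1.2.1 (h1 a (Fin.rev_lt_rev.1 ha'.2))
  have hleg : ∀ j, rowIdx t i < j → j < (rowIdx t i).rev →
      ∃ a, a < rowIdx t i ∧ (a, j) ∈ mainc A := by
    intro j hj hj'
    have hm := mem_limb₀_of_mem_Limb
      (hL ⟨mem_pUP_iff.2 ⟨hj, Or.inl hj'⟩, rfl⟩) (show (rowIdx t i, j) ∈ UP t n from ⟨hj, hj'⟩)
    simp only [limb₀, Set.mem_iUnion] at hm
    obtain ⟨⟨a, b⟩, hp, hm | hm⟩ := hm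
    · exfalso
      have hb : rowIdx t i = b.rev := hm.2
      obtain rfl : b = (rowIdx t i).rev := by rw [hb, Fin.rev_rev]
      rcases (mem_pUP_iff.1 hp.1).2 with h2 | ⟨h2, -⟩
      · exact hp.2.1 (h1 a (Fin.rev_lt_rev.1 h2))
      · exact ht h2
    · obtain rfl : j = b := hm.2.1
      exact ⟨a, hm.2.2, hp⟩
  have h0 : ∀ j, rowIdx t i < j → j < (rowIdx t i).rev → y.1 (rowIdx t i) j = 0 := by
    intro j
    -- The condition at `(a,i)`, for the main condition `(a,j)` above `(i,j)`, is triangular: later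
    -- terms vanish since row `a` ends at `j`, earlier ones by induction. Hence `A_{aj} y_{ij} = 0`.
    induction j using WellFoundedLT.induction with
    | ind j ih =>
      intro hj hj'
      obtain ⟨a, ha, hm⟩ := hleg j hj hj'
      have h2 := hfix.2 a _ ha
      rw [Finset.sum_eq_add (rowIdx t i) j hj.ne, (rowElements_mem_U hy).1.2, mul_one,
        add_eq_left] at h2
      · exact (mul_eq_zero.1 h2).resolve_left hm.2.1
      · intro k _ hk
        rcases lt_or_gt_of_ne hk.2 with hkj | hkj
        · rcases lt_or_gt_of_ne hk.1 with hki | hki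
          · rw [rowElements_apply_left hy hki, mul_zero]
          · rw [ih k hkj hki (hkj.trans hj'), mul_zero]
        · rw [hm.2.2 k hkj, zero_mul]
      · simp
      · simp
  refine rowElements_ext hF hy (one_mem _) (fun j hj hj' => ?_) fun h => absurd h ht
  rw [h0 j hj hj', Units.val_one, Matrix.one_apply_ne hj.ne]

lemma stabRow_eq_X [Finite F] (hF : ringChar F ≠ 2) {A : V .C n F} (hst : IsStaircase A)
    (hcore : IsCore A) (hm : (rowIdx .C i, (rowIdx .C i).rev) ∈ mainc A) {y : GL (Idx .C n) F} :
    y ∈ fixMat A ∧ y ∈ rowElements .C F i ↔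
      y ∈ X .C n F (rowIdx .C i) (rowIdx .C i).rev := by
  have hrow : ∀ c : F, ∀ j, rowIdx .C i < j → j < (rowIdx .C i).rev →
      (x .C n (rowIdx .C i) (rowIdx .C i).rev c).1 (rowIdx .C i) j = 0 := by
    intro c j hj hj'
    rw [coe_x_rev_apply, Matrix.one_apply_ne hj.ne, if_neg hj'.ne, add_zero]
  constructor
  · rintro ⟨hfix, hy⟩
    have hfix' : y * 1 ∈ fixMat A := by rwa [mul_one]
    refine ⟨y.1 (rowIdx .C i) (rowIdx .C i).rev, rowElements_ext hF hy
      (x_mem_rowElements hF (mem_pUP_rev_of_C i) _) (fun j hj hj' => ?_) fun _ => ?_⟩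
    · rw [hrow _ j hj hj']
      exact rowElements_apply_eq_zero_of_apply_rev_ne_zero hcore le_rfl hm.2.1 hy (one_mem _)
        hfix' hj hj'
    · rw [coe_x_rev_apply, if_pos rfl, Matrix.one_apply_ne (rowIdx_lt_rev i).ne, zero_add]
  · rintro ⟨c, rfl⟩
    have hy := x_mem_rowElements (i := i) hF (mem_pUP_rev_of_C i) c
    refine ⟨mem_fixMat_of_apply_eq_zero (fun a ha => ?_) hy (hrow c), hy⟩
    by_contra hne
    -- A non-zero entry above `(i,ī)` would be a second main condition in the same column.
    have := hst _ (hcore.apply_rev_ne_zero hne).1 _ hm rfl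
    exact ha.ne (congrArg Prod.fst this)

/-- The entries of `xRow` are the parameters `α` except possibly in the corner, and there the
coefficient from `A` is zero. This makes the stabilizer condition linear in `α`. -/
lemma sum_xRow_apply (hF : ringChar F ≠ 2) (hA : ∀ a, A.1 a (rowIdx t i).rev = 0)
    (α : RowCols t n (rowIdx t i) → F) [Fintype (RowCols t n (rowIdx t i))] (a : Idx t n) :
    ∑ k, A.1 a k * (xRow (rowIdx t i) α).1 (rowIdx t i) k =
      A.1 a (rowIdx t i) + ∑ j : RowCols t n (rowIdx t i), A.1 a j * α j := by
  classical
  have hy := xRow_mem_rowElements hF α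
  rw [← Finset.add_sum_erase _ _ (Finset.mem_univ (rowIdx t i)), (rowElements_mem_U hy).1.2,
    mul_one]
  congr 1
  have h1 : ∑ j : RowCols t n (rowIdx t i), A.1 a j * α j =
      ∑ j : RowCols t n (rowIdx t i), A.1 a j * (xRow (rowIdx t i) α).1 (rowIdx t i) j := by
    refine Finset.sum_congr rfl fun j _ => ?_
    by_cases hj : j.1 = (rowIdx t i).rev
    · rw [hj, hA, zero_mul, zero_mul]
    · rw [xRow_apply hF α j hj]
  rw [h1, ← Finset.sum_subtype (Finset.univ.filter fun j => (rowIdx t i, j) ∈ pUP t n) (by simp)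
    (fun k => A.1 a k * (xRow (rowIdx t i) α).1 (rowIdx t i) k)]
  symm
  refine Finset.sum_subset (fun j hj => ?_) fun k hk hk' => ?_
  · exact Finset.mem_erase.2 ⟨(lt_of_mem_pUP (Finset.mem_filter.1 hj).2).ne', Finset.mem_univ _⟩
  · rcases lt_or_gt_of_ne (Finset.ne_of_mem_erase hk) with h2 | h2
    · rw [rowElements_apply_left hy h2, mul_zero]
    rcases lt_trichotomy k (rowIdx t i).rev with h3 | rfl | h3
    · exact absurd (by simpa using mem_pUP_iff.2 ⟨h2, Or.inl h3⟩) hk'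
    · rw [hA, zero_mul]
    · rw [rowElements_apply_right hy h3, mul_zero]

lemma mem_solSpace_iff [Fintype (RowCols t n (rowIdx t i))] {α : RowCols t n (rowIdx t i) → F} :
    α ∈ solSpace A (rowIdx t i) ↔
      ∀ a, a < rowIdx t i → ∑ j : RowCols t n (rowIdx t i), A.1 a j * α j = 0 := by
  rw [solSpace, LinearMap.mem_ker, funext_iff]
  simp only [Subtype.forall]
  refine forall₂_congr fun a ha => ?_
  simp only [Matrix.mulVecLin_apply, Matrix.mulVec, dotProduct, subMat, Matrix.submatrix_apply,
    Pi.zero_apply]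
  convert Iff.rfl

lemma stabRow_eq_solSpace [Finite F] (hF : ringChar F ≠ 2) (hA : ∀ a, A.1 a (rowIdx t i).rev = 0)
    {y : GL (Idx t n) F} :
    y ∈ fixMat A ∧ y ∈ rowElements t F i ↔
      ∃ α ∈ solSpace A (rowIdx t i), y = xRow (rowIdx t i) α := by
  classical
  have key : ∀ α : RowCols t n (rowIdx t i) → F,
      xRow (rowIdx t i) α ∈ fixMat A ↔ α ∈ solSpace A (rowIdx t i) := by
    intro α
    rw [mem_fixMat_iff_of_col_eq_zero hA (xRow_mem_rowElements hF α), mem_solSpace_iff]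
    simp only [sum_xRow_apply hF hA, add_eq_left]
  constructor
  · rintro ⟨hfix, hy⟩
    obtain ⟨α, rfl⟩ := exists_xRow_eq hF hy
    exact ⟨α, (key α).1 hfix, rfl⟩
  · rintro ⟨α, hα, rfl⟩
    exact ⟨(key α).2 hα, xRow_mem_rowElements hF α⟩

end RowStabilizers

/-! ### Unique factorization along a descending chain. -/

section Factorization

/-- Existence of factorizations along a chain of subsets. -/
lemma exists_ofFn_prod_eq {G : Type*} [Monoid G] {n : ℕ} {H : ℕ → Set G} {R : Fin n → Set G}
    (hn : ∀ g ∈ H n, g = 1)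
    (hH : ∀ i : Fin n, ∀ g ∈ H i, ∃ y ∈ R i, ∃ w ∈ H (i + 1), g = y * w) {g : G} (hg : g ∈ H 0) :
    ∃ y : Fin n → G, (∀ i, y i ∈ R i) ∧ (List.ofFn y).prod = g := by
  induction n generalizing H g with
  | zero => exact ⟨fun _ => 1, fun i => i.elim0, by simp [hn g hg]⟩
  | succ n ih =>
    obtain ⟨y₀, hy₀, w, hw, rfl⟩ := hH 0 g hg
    obtain ⟨y, hy, rfl⟩ := ih (H := fun k => H (k + 1)) (R := fun i => R i.succ) hn
      (fun i => hH i.succ) hw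
    exact ⟨Fin.cons y₀ y, fun i => Fin.cases hy₀ hy i, by simp [List.ofFn_succ]⟩

lemma ofFn_prod_mem_of_antitone {G : Type*} [Monoid G] {n : ℕ} {H : ℕ → Submonoid G}
    (hH : Antitone H) {y : Fin n → G} (hy : ∀ i : Fin n, y i ∈ H i) : (List.ofFn y).prod ∈ H 0 := by
  refine Submonoid.list_prod_mem _ fun g hg => ?_
  obtain ⟨i, rfl⟩ := (List.mem_ofFn' y g).1 hg
  exact hH (Nat.zero_le _) (hy i)

/-- Uniqueness of factorizations along a chain of submonoids. -/
lemma ofFn_prod_injOn {G : Type*} [Group G] {n : ℕ} {H : ℕ → Submonoid G} {R : Fin n → Set G}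
    (hH : Antitone H) (hR : ∀ i : Fin n, R i ⊆ H i)
    (huniq : ∀ i : Fin n, ∀ y ∈ R i, ∀ z ∈ R i, ∀ w ∈ H (i + 1), ∀ w' ∈ H (i + 1),
      y * w = z * w' → y = z)
    {y z : Fin n → G} (hy : ∀ i, y i ∈ R i) (hz : ∀ i, z i ∈ R i)
    (h : (List.ofFn y).prod = (List.ofFn z).prod) : y = z := by
  induction n generalizing H with
  | zero => exact funext fun i => i.elim0
  | succ n ih =>
    rw [List.ofFn_succ, List.ofFn_succ, List.prod_cons, List.prod_cons] at h
    have hH' : Antitone fun k => H (k + 1) := fun _ _ h => hH (Nat.succ_le_succ h)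
    have hmem : ∀ y : Fin (n + 1) → G, (∀ i, y i ∈ R i) →
        (List.ofFn fun i : Fin n => y i.succ).prod ∈ H 1 := fun y hy =>
      ofFn_prod_mem_of_antitone hH' fun i => hR i.succ (hy i.succ)
    have h0 : y 0 = z 0 := huniq 0 _ (hy 0) _ (hz 0) _ (hmem y hy) _ (hmem z hz) h
    rw [h0, mul_right_inj] at h
    have h1 := ih (H := fun k => H (k + 1)) (R := fun i => R i.succ) hH' (fun i => hR i.succ)
      (fun i => huniq i.succ) (fun i => hy i.succ) (fun i => hz i.succ) h
    exact funext fun i => Fin.cases h0 (fun i => congrFun h1 i) i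

end Factorization

end ClassicalSylow

/-- Row stabilizers of staircase cores, and the unique row factorization of the stabilizer. -/
theorem mainTheorem2 {F : Type*} [Field F] [Finite F] (hF : ringChar F ≠ 2)
    (t : LieType) (n : ℕ) (θ : AddChar F ℂ) (hθ : θ ≠ 1)
    (A : V t n F) (hst : IsStaircase A) (hcore : IsCore A) :
    (∀ i : Fin n,
      (rowPos t n (rowIdx t i) ⊆ Limb A → StabRow θ A (rowIdx t i) = {1}) ∧
      (t = LieType.C → (rowIdx t i, (rowIdx t i).rev) ∈ mainc A →
        StabRow θ A (rowIdx t i) = X t n F (rowIdx t i) (rowIdx t i).rev) ∧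
      (¬ rowPos t n (rowIdx t i) ⊆ Limb A →
        ¬ (t = LieType.C ∧ (rowIdx t i, (rowIdx t i).rev) ∈ mainc A) →
        StabRow θ A (rowIdx t i) = {y | ∃ α ∈ solSpace A (rowIdx t i), y = xRow (rowIdx t i) α})) ∧
    Set.BijOn (fun y : Fin n → GL (Idx t n) F => (List.ofFn y).prod)
      {y | ∀ i : Fin n, y i ∈ StabRow θ A (rowIdx t i)} (Stab θ A) := by
  have hSR : ∀ i y, y ∈ StabRow θ A (rowIdx t i) ↔ y ∈ fixMat A ∧ y ∈ rowElements t F i :=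
    fun i y => mem_StabRow_iff hF hθ
  refine ⟨fun i => ⟨fun hL => ?_, fun ht hm => ?_, fun hL hC => ?_⟩, fun y hy => ?_,
    fun y hy z hz h => ?_, fun u hu => ?_⟩
  · ext y
    rw [hSR, Set.mem_singleton_iff]
    refine ⟨fun h => stabRow_eq_one hF hcore hL h.1 h.2, ?_⟩
    rintro rfl
    exact ⟨one_mem _, one_mem _⟩
  · subst ht
    ext y
    rw [hSR]
    exact stabRow_eq_X hF hst hcore hm
  -- A non-zero entry of column `ī` above row `i` would put the row into `Limb A`, and one in row
  -- `i` would be the excluded main condition of type `C`. Below row `i` the column is outside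
  -- `pUP`.
  · have hA : ∀ a, A.1 a (rowIdx t i).rev = 0 := by
      intro a
      by_contra hne
      rcases lt_trichotomy a (rowIdx t i) with ha | rfl | ha
      · exact hL (rowPos_subset_Limb hcore ha hne)
      · have hm := (hcore.apply_rev_ne_zero hne).1
        refine hC ⟨?_, hm⟩
        rcases (mem_pUP_iff.1 hm.1).2 with h | ⟨h, -⟩
        · exact absurd h (lt_irrefl _)
        · exact h
      · exact hne (apply_rev_eq_zero_of_lt A ha)
    ext y
    rw [hSR]
    exact stabRow_eq_solSpace hF hA
  · refine (mem_Stab_iff hθ).2 (Submonoid.list_prod_mem _ fun g hg => ?_)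
    obtain ⟨i, rfl⟩ := (List.mem_ofFn' y g).1 hg
    exact ((hSR i _).1 (hy i)).1
  · refine ofFn_prod_injOn (H := fixRows t n F) (R := fun i => rowElements t F i)
      (fun _ _ h => fixRows_anti h) (fun _ _ h => h.1) (fun i y hy z hz w hw w' hw' e => ?_)
      (fun i => ((hSR i _).1 (hy i)).2) (fun i => ((hSR i _).1 (hz i)).2) h
    -- This element differs from `1` at most in row `i` and column `ī`, yet its row `i` is trivial;
    -- so it is `1`.
    have h1 : z⁻¹ * y = w' * w⁻¹ := by
      rw [eq_mul_inv_iff_mul_eq, mul_assoc, e, inv_mul_cancel_left]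
    have h2 : z⁻¹ * y = 1 := rowElements_inter_fixRows (mul_mem (inv_mem_rowElements hz) hy)
      (h1 ▸ mul_mem hw' (Submonoid.inv_mem_of_finite _ hw))
    exact (inv_mul_eq_one.1 h2).symm
  · have hu' := (mem_Stab_iff hθ).1 hu
    -- The chain is the filtration `fixRows` intersected with the stabilizer; `left_mem_fixMat`
    -- keeps both factors inside the stabilizer at each step.
    refine exists_ofFn_prod_eq (H := fun k => {g | g ∈ fixMat A ∧ g ∈ fixRows t n F k})
      (R := fun i => StabRow θ A (rowIdx t i)) (fun g hg => eq_one_of_mem_fixRows hg.2)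
      (fun i g hg => ?_) ⟨hu', mem_fixRows_zero.2 hu'.1⟩
    obtain ⟨y, hy, w, hw, rfl⟩ := fixRows_decomposition hF hg.2
    have hyA := left_mem_fixMat hcore hy hw hg.1
    refine ⟨y, (hSR i y).2 ⟨hyA, hy⟩, w, ⟨?_, hw⟩, rfl⟩
    have := mul_mem (Submonoid.inv_mem_of_finite _ hyA) hg.1
    rwa [inv_mul_cancel_left] at this
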